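/- A \emph{two-valued group} is a set $X$ with a multiplication $*\colon X\times X\to \mathrm{Sym}^2(X)$ taking values in the set of two-element multisets $[a,b]$ of elements of $X$ (repetitions allowed), an identity $e\in X$ and an inverse $x\mapsto x^{-1}$ such that (1) $x*(y*z)=(x*y)*z$ as four-element multisets for all $x,y,z$; (2) $e*x=x*e=[x,x]$ for all $x$; (3) $e\in x*x^{-1}$ and $e\in x^{-1}*x$ for all $x$, and if $e\in x*y$ or $e\in y*x$, then $y=x^{-1}$. It is \emph{commutative} if $x*y=y*x$ for all $x,y$, and \emph{involutive} if $x^{-1}=x$ for all $x$. For an element $x$ of an involutive two-valued group there is a unique sequence $(x^k)_{k\ge 0}$ with $x^0=e$, $x^1=x$ and $x*x^k=x^k*x=[x^{k-1},x^{k+1}]$ for all $k\ge 1$; the \emph{order} of $x$ is the least $k\ge 1$ with $x^k=e$, or $\infty$ if there is no such $k$. A \emph{topological two-valued group} is a two-valued group with a topology on $X$ for which $*$ and $x\mapsto x^{-1}$ are continuous, where $\mathrm{Sym}^2(X)$ has the quotient topology from $X\times X$. For a commutative topological group $A$ (written multiplicatively), let $\iota_{\mathbf a}(a)=a^{-1}$,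 and let $A/\iota_{\mathbf a}$ be the topological two-valued group formed by the quotient space of $A$ by $a\sim a^{-1}$, with projection $\pi\colon A\to A/\iota_{\mathbf a}$, multiplication $\pi(a)*\pi(b)=[\pi(ab),\pi(ab^{-1})]$, identity $\pi(1)$ and inverse $\pi(a)^{-1}=\pi(a^{-1})$. An isomorphism of topological two-valued groups is a homeomorphism that respects multiplication, identity and inverse. \textbf{Theorem.} Let $X$ be an involutive commutative Hausdorff topological two-valued group that contains at least one element whose order (possibly infinite) is neither $1$, nor $2$, nor $4$. Then there is a commutative Hausdorff topological group $A$ such that $X$ is isomorphic, as a topological two-valued group, to $A/\iota_{\mathbf a}$. -/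

import Mathlib

universe u

/-- A two-valued group structure on a set `X`. The two-element multiset `x * y` is an element of the
symmetric square `Sym2 X`; the symmetric square is the set of two-element multisets, so `s(a, a)`
is allowed. -/
class TwoValuedGroup (X : Type*) where
  /-- two-valued multiplication -/
  mul : X → X → Sym2 X
  /-- the identity `e` -/
  one : X
  /-- the inverse -/
  inv : X → X
  /-- associativity: `x * (y * z) = (x * y) * z` as four-element multisets -/
  mul_assoc : ∀ x y z : X,
    (mul y z).toMultiset.bind (fun w => (mul x w).toMultiset) =
      (mul x y).toMultiset.bind (fun w => (mul w z).toMultiset)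
  /-- strong identity -/
  one_mul : ∀ x : X, mul one x = s(x, x)
  mul_one : ∀ x : X, mul x one = s(x, x)
  /-- existence of the inverse -/
  one_mem_mul_inv : ∀ x : X, one ∈ mul x (inv x)
  one_mem_inv_mul : ∀ x : X, one ∈ mul (inv x) x
  /-- uniqueness of the inverse -/
  eq_inv_of_one_mem : ∀ x y : X, (one ∈ mul x y ∨ one ∈ mul y x) → y = inv x

namespace TwoValuedGroup

/-- `x * y = y * x` for all `x, y`. -/
def IsCommutative (X : Type*) [TwoValuedGroup X] : Prop :=
  ∀ x y : X, mul x y = mul y x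

/-- Every element is a weak involution, `x⁻¹ = x`. -/
def IsInvolutive (X : Type*) [TwoValuedGroup X] : Prop :=
  ∀ x : X, inv x = x

open Classical in
/-- Removal of one copy of `a` from the two-element multiset `z`, if `a ∈ z`
(and `a` itself otherwise). -/
noncomputable def remove {X : Type*} (z : Sym2 X) (a : X) : X :=
  if h : a ∈ z then Sym2.Mem.other h else a

/-- The pair `(x ^ k, x ^ (k + 1))`. -/
noncomputable def powPair {X : Type*} [TwoValuedGroup X] (x : X) : ℕ → X × X
  | 0 => (one, x)
  | k + 1 => ((powPair x k).2, remove (mul x (powPair x k).2) (powPair x k).1)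

/-- The powers of an element `x` of an involutive two-valued group:
`x ^ 0 = e`, `x ^ 1 = x`, and `x * x ^ k = x ^ k * x = [x ^ (k - 1), x ^ (k + 1)]` for `k ≥ 1`.
See `pow_zero`, `pow_one`, `mul_pow_succ`, `pow_succ_mul` and `eq_pow` for the proof that this is
the only sequence with these properties. -/
noncomputable def pow {X : Type*} [TwoValuedGroup X] (x : X) (k : ℕ) : X :=
  (powPair x k).1

/-- The order of `x`: the least `k ≥ 1` with `x ^ k = e`, and `⊤` if there is none. -/
noncomputable def order {X : Type*} [TwoValuedGroup X] (x : X) : ℕ∞ :=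
  ⨅ k ∈ {k : ℕ | 1 ≤ k ∧ pow x k = one}, (k : ℕ∞)

theorem toMultiset_mk {X : Type*} (a b : X) : (s(a, b)).toMultiset = {a, b} := rfl

theorem toMultiset_injective {X : Type*} :
    Function.Injective (Sym2.toMultiset : Sym2 X → Multiset X) := by
  intro z w h
  induction z with | _ a b =>
  induction w with | _ c d =>
  rw [toMultiset_mk, toMultiset_mk] at h
  have h' : ({a, b} : Multiset X) = {c, d} := h
  rw [Multiset.insert_eq_cons, Multiset.insert_eq_cons, Multiset.cons_eq_cons] at h'
  rw [Sym2.eq_iff]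
  rcases h' with ⟨h1, h2⟩ | ⟨-, cs, h1, h2⟩
  · exact Or.inl ⟨h1, Multiset.singleton_inj.1 h2⟩
  · have ha : a ∈ ({d} : Multiset X) := by rw [h2]; exact Multiset.mem_cons_self _ _
    have hc : c ∈ ({b} : Multiset X) := by rw [h1]; exact Multiset.mem_cons_self _ _
    exact Or.inr ⟨Multiset.mem_singleton.1 ha, (Multiset.mem_singleton.1 hc).symm⟩

theorem remove_spec {X : Type*} {z : Sym2 X} {a : X} (h : a ∈ z) : s(a, remove z a) = z := by
  unfold remove
  rw [dif_pos h]
  exact Sym2.other_spec h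

section Powers

variable {X : Type*} [TwoValuedGroup X]

theorem mem_mul_of_mem_mul (hX : IsInvolutive X) {x y z : X} (h : z ∈ mul x y) :
    x ∈ mul y z := by
  have h1 : (one : X) ∈ (mul x y).toMultiset.bind (fun w => (mul w z).toMultiset) := by
    rw [Multiset.mem_bind]
    refine ⟨z, Sym2.mem_toMultiset.2 h, Sym2.mem_toMultiset.2 ?_⟩
    have := one_mem_mul_inv z
    rwa [hX z] at this
  rw [← mul_assoc, Multiset.mem_bind] at h1
  obtain ⟨w, hw, hw'⟩ := h1
  have := eq_inv_of_one_mem x w (Or.inl (Sym2.mem_toMultiset.1 hw'))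
  rw [hX x] at this
  exact this ▸ Sym2.mem_toMultiset.1 hw

theorem pow_zero (x : X) : pow x 0 = one := rfl

theorem pow_one (x : X) : pow x 1 = x := rfl

theorem pow_add_two (x : X) (k : ℕ) :
    pow x (k + 2) = remove (mul x (pow x (k + 1))) (pow x k) := rfl

theorem mul_pow_aux (hX : IsInvolutive X) (x : X) (k : ℕ) :
    mul x (pow x k) = mul (pow x k) x ∧
      mul x (pow x (k + 1)) = mul (pow x (k + 1)) x ∧
      mul x (pow x (k + 1)) = s(pow x k, pow x (k + 2)) := by
  induction k with
  | zero =>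
    refine ⟨?_, rfl, ?_⟩
    · rw [pow_zero, one_mul, mul_one]
    · rw [pow_add_two, remove_spec]
      rw [pow_zero, pow_one]
      have := one_mem_mul_inv x
      rwa [hX x] at this
  | succ k ih =>
    obtain ⟨h0, h1, h2⟩ := ih
    have hc : mul x (pow x (k + 2)) = mul (pow x (k + 2)) x := by
      have h := mul_assoc x (pow x (k + 1)) x
      rw [← h1, h2, toMultiset_mk, Multiset.insert_eq_cons, Multiset.cons_bind,
        Multiset.singleton_bind, Multiset.cons_bind, Multiset.singleton_bind, h0] at h
      exact toMultiset_injective (add_left_cancel h)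
    refine ⟨h1, hc, ?_⟩
    rw [pow_add_two x (k + 1), remove_spec]
    rw [hc]
    refine mem_mul_of_mem_mul hX (mem_mul_of_mem_mul hX (mem_mul_of_mem_mul hX (mem_mul_of_mem_mul hX ?_)))
    refine mem_mul_of_mem_mul hX ?_
    rw [h2]
    exact Sym2.mem_mk_right _ _

theorem mul_pow_succ (hX : IsInvolutive X) (x : X) (k : ℕ) :
    mul x (pow x (k + 1)) = s(pow x k, pow x (k + 2)) :=
  (mul_pow_aux hX x k).2.2

theorem pow_succ_mul (hX : IsInvolutive X) (x : X) (k : ℕ) :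
    mul (pow x (k + 1)) x = s(pow x k, pow x (k + 2)) := by
  rw [← (mul_pow_aux hX x k).2.1, mul_pow_succ hX]

theorem eq_pow (hX : IsInvolutive X) (x : X) (p : ℕ → X) (h0 : p 0 = one) (h1 : p 1 = x)
    (h : ∀ k, mul x (p (k + 1)) = s(p k, p (k + 2))) (k : ℕ) : p k = pow x k := by
  have key : ∀ k, p k = pow x k ∧ p (k + 1) = pow x (k + 1) := by
    intro k
    induction k with
    | zero => exact ⟨h0, h1⟩
    | succ k ih =>
      refine ⟨ih.2, ?_⟩
      have := h k
      rw [ih.1, ih.2, mul_pow_succ hX] at this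
      exact (Sym2.congr_right.1 this).symm
  exact (key k).1

end Powers

/-! ### Topological two-valued groups -/

/-- The topology on `Sym2 X` is the quotient of the product topology on `X × X`. -/
theorem topology_sym2 (X : Type*) [TopologicalSpace X] :
    (inferInstance : TopologicalSpace (Sym2 X)) =
      TopologicalSpace.coinduced (fun p : X × X => s(p.1, p.2)) inferInstance := rfl

end TwoValuedGroup

/-- A topological two-valued group: multiplication `X × X → Sym2 X` and inversion are continuous. -/
class IsTopologicalTwoValuedGroup (X : Type*) [TopologicalSpace X] [TwoValuedGroup X] : Prop where
  continuous_mul : Continuous (fun p : X × X => TwoValuedGroup.mul p.1 p.2)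
  continuous_inv : Continuous (fun x : X => TwoValuedGroup.inv x)

/-- Isomorphisms of topological two-valued groups: homeomorphisms that respect the two-valued
multiplication, the identity and the inverse. -/
structure TopologicalTwoValuedGroupIso (X Y : Type*) [TopologicalSpace X] [TwoValuedGroup X]
    [TopologicalSpace Y] [TwoValuedGroup Y] extends X ≃ₜ Y where
  map_mul : ∀ x y : X, TwoValuedGroup.mul (toFun x) (toFun y) =
    (TwoValuedGroup.mul x y).map toFun
  map_one : toFun TwoValuedGroup.one = TwoValuedGroup.one
  map_inv : ∀ x : X, toFun (TwoValuedGroup.inv x) = TwoValuedGroup.inv (toFun x)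

/-! ### Coset two-valued groups -/

/-- The equivalence relation whose classes are the orbits `{g, ι g}` of an involutive
automorphism `ι`. -/
def cosetSetoid {G : Type*} [Group G] (ι : G ≃* G) (hι : Function.Involutive ι) : Setoid G where
  r g h := h = g ∨ h = ι g
  iseqv :=
    { refl := fun _ => Or.inl rfl
      symm := by
        rintro g h (rfl | rfl)
        · exact Or.inl rfl
        · exact Or.inr (hι g).symm
      trans := by
        rintro g h k (rfl | rfl) (rfl | rfl)
        · exact Or.inl rfl
        · exact Or.inr rfl
        · exact Or.inr rfl
        · exact Or.inl (hι g) }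

/-- The quotient set `G / ι`. -/
def CosetTwoValued {G : Type*} [Group G] (ι : G ≃* G) (hι : Function.Involutive ι) : Type _ :=
  Quotient (cosetSetoid ι hι)

namespace CosetTwoValued

variable {G : Type*} [Group G] {ι : G ≃* G} {hι : Function.Involutive ι}

/-- The projection `G → G / ι`. -/
def proj (ι : G ≃* G) (hι : Function.Involutive ι) (g : G) : CosetTwoValued ι hι :=
  Quotient.mk (cosetSetoid ι hι) g

theorem proj_eq_iff {g h : G} : proj ι hι g = proj ι hι h ↔ h = g ∨ h = ι g :=
  Quotient.eq (r := cosetSetoid ι hι)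

theorem proj_map (g : G) : proj ι hι (ι g) = proj ι hι g :=
  (proj_eq_iff.2 (Or.inr rfl)).symm

theorem proj_surjective : Function.Surjective (proj ι hι) := Quotient.mk_surjective

/-- `π(g) * π(h) = [π(g h), π(g ι(h))]`. -/
def mul (a b : CosetTwoValued ι hι) : Sym2 (CosetTwoValued ι hι) :=
  Quotient.liftOn₂ a b (fun g h => s(proj ι hι (g * h), proj ι hι (g * ι h))) <| by
    have key : ∀ g h : G,
        proj ι hι (ι g * h) = proj ι hι (g * ι h) := by
      intro g h
      rw [← proj_map (g * ι h), _root_.map_mul, hι h]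
    rintro g h g' h' (rfl | rfl) (rfl | rfl)
    · rfl
    · simp only [hι h]
      exact Sym2.eq_swap
    · simp only [key, hι _]
      exact Sym2.eq_swap
    · simp only [key, hι _]

/-- `π(g)⁻¹ = π(g⁻¹)`. -/
def inv (a : CosetTwoValued ι hι) : CosetTwoValued ι hι :=
  Quotient.liftOn a (fun g => proj ι hι g⁻¹) <| by
    rintro g g' (rfl | rfl)
    · rfl
    · simp only [← map_inv, proj_map]

theorem mul_proj (g h : G) :
    mul (proj ι hι g) (proj ι hι h) = s(proj ι hι (g * h), proj ι hι (g * ι h)) := rfl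

theorem inv_proj (g : G) : inv (proj ι hι g) = proj ι hι g⁻¹ := rfl

instance : TwoValuedGroup (CosetTwoValued ι hι) where
  mul := mul
  one := proj ι hι 1
  inv := inv
  mul_assoc x y z := by
    obtain ⟨g, rfl⟩ := proj_surjective x
    obtain ⟨h, rfl⟩ := proj_surjective y
    obtain ⟨k, rfl⟩ := proj_surjective z
    simp only [mul_proj, TwoValuedGroup.toMultiset_mk, Multiset.insert_eq_cons,
      Multiset.cons_bind, Multiset.singleton_bind, _root_.map_mul, hι k, _root_.mul_assoc]
    simp only [← Multiset.singleton_add]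
    abel
  one_mul x := by
    obtain ⟨g, rfl⟩ := proj_surjective x
    rw [mul_proj, _root_.one_mul, _root_.one_mul, proj_map]
  mul_one x := by
    obtain ⟨g, rfl⟩ := proj_surjective x
    rw [mul_proj, map_one, _root_.mul_one]
  one_mem_mul_inv x := by
    obtain ⟨g, rfl⟩ := proj_surjective x
    rw [inv_proj, mul_proj, mul_inv_cancel]
    exact Sym2.mem_mk_left _ _
  one_mem_inv_mul x := by
    obtain ⟨g, rfl⟩ := proj_surjective x
    rw [inv_proj, mul_proj, inv_mul_cancel]
    exact Sym2.mem_mk_left _ _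
  eq_inv_of_one_mem x y := by
    obtain ⟨g, rfl⟩ := proj_surjective x
    obtain ⟨h, rfl⟩ := proj_surjective y
    have h1 : ∀ a : G, proj ι hι 1 = proj ι hι a → a = 1 := by
      intro a ha
      rcases proj_eq_iff.1 ha with h | h
      · exact h
      · rw [h, map_one]
    rw [inv_proj, mul_proj, mul_proj, Sym2.mem_iff, Sym2.mem_iff]
    rintro ((e | e) | (e | e))
    · rw [eq_inv_of_mul_eq_one_right (h1 _ e)]
    · rw [← eq_inv_of_mul_eq_one_right (h1 _ e), proj_map]
    · rw [eq_inv_of_mul_eq_one_left (h1 _ e)]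
    · rw [eq_inv_of_mul_eq_one_left (h1 _ e), ← map_inv, proj_map]

/-- `G / ι` carries the quotient topology. -/
instance [TopologicalSpace G] : TopologicalSpace (CosetTwoValued ι hι) :=
  inferInstanceAs (TopologicalSpace (Quotient (cosetSetoid ι hι)))

theorem isOpenQuotientMap_proj [TopologicalSpace G] (hc : Continuous ι) :
    IsOpenQuotientMap (proj ι hι) where
  surjective := proj_surjective
  continuous := continuous_quot_mk
  isOpenMap := by
    intro U hU
    have hq : Topology.IsQuotientMap (proj ι hι) := isQuotientMap_quot_mk
    rw [← hq.isOpen_preimage]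
    have : proj ι hι ⁻¹' (proj ι hι '' U) = U ∪ ι ⁻¹' U := by
      ext g
      constructor
      · rintro ⟨u, hu, e⟩
        rcases proj_eq_iff.1 e with h | h
        · exact Or.inl (h ▸ hu)
        · refine Or.inr ?_
          rw [Set.mem_preimage, h, hι u]
          exact hu
      · rintro (h | h)
        · exact ⟨g, h, rfl⟩
        · exact ⟨ι g, h, proj_map g⟩
    rw [this]
    exact hU.union (hU.preimage hc)

/-- If `ι` is continuous, then `G / ι` is a topological two-valued group. -/
theorem isTopologicalTwoValuedGroup [TopologicalSpace G] [IsTopologicalGroup G]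
    (hc : Continuous ι) : IsTopologicalTwoValuedGroup (CosetTwoValued ι hι) where
  continuous_mul := by
    have hq := isOpenQuotientMap_proj (hι := hι) hc
    rw [← (hq.prodMap hq).continuous_comp_iff]
    have h1 : Continuous (fun p : G × G => (proj ι hι (p.1 * p.2), proj ι hι (p.1 * ι p.2))) :=
      (hq.continuous.comp (continuous_fst.mul continuous_snd)).prodMk
        (hq.continuous.comp (continuous_fst.mul (hc.comp continuous_snd)))
    exact continuous_quot_mk.comp h1
  continuous_inv := by
    have hq := isOpenQuotientMap_proj (hι := hι) hc
    rw [← hq.continuous_comp_iff]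
    exact hq.continuous.comp continuous_inv

end CosetTwoValued

/-- The antipodal involution `ι_a(a) = a⁻¹` of an abelian group. -/
def antipodal (A : Type*) [CommGroup A] : A ≃* A := MulEquiv.inv A

theorem antipodal_apply {A : Type*} [CommGroup A] (a : A) : antipodal A a = a⁻¹ := rfl

theorem antipodal_involutive (A : Type*) [CommGroup A] : Function.Involutive (antipodal A) :=
  fun a => inv_inv a

/-- The coset two-valued group `A / ι_a` of an abelian group `A`. -/
abbrev AntipodalCoset (A : Type*) [CommGroup A] : Type _ :=
  CosetTwoValued (antipodal A) (antipodal_involutive A)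

instance (A : Type*) [CommGroup A] [TopologicalSpace A] [IsTopologicalGroup A] :
    IsTopologicalTwoValuedGroup (AntipodalCoset A) :=
  CosetTwoValued.isTopologicalTwoValuedGroup (continuous_inv (G := A))

/-!
The group `A` is recovered from `X` together with one element `t` with `t ^ 2 ≠ e` and `t ^ 4 ≠ e`.
If `X = A / ι_a` and `t = π a`, then an element `b` of `A` is determined by the pair `(π b, π (a b))`,
or equivalently by the sequence `k ↦ π (a ^ k b)`. Such sequences can be described inside `X`: they
are the *lines* `f : ℤ → X` with `t * f k = [f (k - 1), f (k + 1)]`, and every pair `(x, y)` with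
`y ∈ t * x` extends to exactly one line. So `A` is taken to be the set of `t`-lines, with the topology
of a subspace of `X × X`, and the projection to `X` is `f ↦ f 0`. The product `h` of two lines `f` and
`g` and the product `w` of `f` with the inverse of `g` should satisfy

  `f k * g l = [h (k + l), w (k - l)]` for all `k` and `l`.

Existence of `h` and `w` is the main point. All computations take place in a commutative ring in which
the elements of `X` are linearly independent and multisets become sums (`exists_linearization`). There
the family `f k * g l` satisfies the discrete d'Alembert equation, hence is additive in `k + l` and
`k - l` (`line_mul_line_additive`). An additive family of two-element multisets either is independent
of one of its two variables or splits off an element of `X` for each of them (`exists_splitting`). The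
degenerate alternatives are excluded first for `f = g` (`self_product_not_degenerate`), which makes
the squares of lines available (`exists_self_product`), and then in general
(`product_not_degenerate`). That the functions `h` and `w` so obtained are lines again
(`isLine_of_product`) uses the identity `f k * h n = [g (n - k), h' (n + k)]`, where `h'` belongs to
the product of the square of `f` with `g`, and the fact that `t ^ 2 - e` does not annihilate a
difference of two distinct elements of `X` (`eq_of_powLine_two_mul`); this is where `t ^ 4 ≠ e` is
used. The same fact gives associativity (`line_product_assoc`).

As for the topology, the projection is open because `x ↦ t * x` is continuous, and `h n` depends
continuously on `f` and `g` because it is a common element of the multisets `f k * g l` with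
`k + l = n`, while `w` is not constant on a parity class (`Lines.continuous_mul`).
-/

open Filter Topology

namespace TwoValuedGroup

/-! ### Linearization -/

/-- A linearization of an involutive two-valued group `X`: a map `φ` from `X` to a commutative ring
that sends the multiset `x * y = [u, v]` to the equation `φ x * φ y = φ u + φ v`, together with
additive functionals `coeff z` that detect the basis vectors. The normalization of `coeff` is
immaterial; twice the coefficient is what the regular representation gives. -/
structure Linearization (X : Type*) [TwoValuedGroup X] (R : Type*) [CommRing R] where
  /-- the basis vector of an element -/
  toFun : X → R
  /-- twice the coefficient of a basis vector -/
  coeff : X → R →+ ℤ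
  involutive : IsInvolutive X
  /-- the identity becomes `2`, since `e * x = [x, x]` -/
  map_one : toFun one = 2
  map_mul : ∀ x y u v : X, mul x y = s(u, v) → toFun x * toFun y = toFun u + toFun v
  coeff_self : ∀ x : X, coeff x (toFun x) = 2
  coeff_ne : ∀ x y : X, x ≠ y → coeff y (toFun x) = 0

/-- The sum of the two basis vectors of a two-element multiset. -/
noncomputable def pairSum {X : Type*} (z : Sym2 X) : X →₀ ℤ :=
  (z.toMultiset.map fun w => Finsupp.single w 1).sum

theorem pairSum_mk {X : Type*} (a b : X) :
    pairSum s(a, b) = Finsupp.single a 1 + Finsupp.single b 1 := by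
  simp [pairSum, toMultiset_mk]

/-- Multiplication by `x` on the free abelian group with basis `X`. -/
noncomputable def mulOp {X : Type*} [TwoValuedGroup X] (x : X) : Module.End ℤ (X →₀ ℤ) :=
  Finsupp.linearCombination ℤ fun y => pairSum (mul x y)

theorem mulOp_single {X : Type*} [TwoValuedGroup X] (x y : X) :
    mulOp x (Finsupp.single y 1) = pairSum (mul x y) := by
  simp [mulOp]

theorem mulOp_mul {X : Type*} [TwoValuedGroup X] {x y u v : X} (h : mul x y = s(u, v)) :
    mulOp x * mulOp y = mulOp u + mulOp v := by
  refine Finsupp.lhom_ext' fun z => LinearMap.ext_ring ?_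
  have key := congrArg (fun m : Multiset X => (m.map fun w => Finsupp.single w (1 : ℤ)).sum)
    (mul_assoc x y z)
  obtain ⟨a, b, hab⟩ : ∃ a b, mul y z = s(a, b) := by
    induction hz : mul y z with | _ a b => exact ⟨a, b, rfl⟩
  simp only [h, hab, toMultiset_mk, Multiset.insert_eq_cons, Multiset.cons_bind,
    Multiset.singleton_bind, Multiset.map_add, Multiset.sum_add] at key
  simp only [LinearMap.comp_apply, Finsupp.lsingle_apply, Module.End.mul_apply,
    LinearMap.add_apply, mulOp_single, hab, pairSum_mk, map_add]
  exact key

open scoped IsMulCommutative in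
theorem exists_linearization {X : Type u} [TwoValuedGroup X] (hinv : IsInvolutive X)
    (hcomm : IsCommutative X) :
    ∃ (R : Type u) (_ : CommRing R), Nonempty (Linearization X R) := by
  classical
  have hc : ∀ a ∈ Set.range (mulOp (X := X)), ∀ b ∈ Set.range (mulOp (X := X)),
      a * b = b * a := by
    rintro _ ⟨x, rfl⟩ _ ⟨y, rfl⟩
    obtain ⟨u, v, h⟩ : ∃ u v, mul x y = s(u, v) := by
      induction hz : mul x y with | _ a b => exact ⟨a, b, rfl⟩
    rw [mulOp_mul h, mulOp_mul ((hcomm y x).trans h)]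
  let S := Algebra.adjoin ℤ (Set.range (mulOp (X := X)))
  have : IsMulCommutative S := Algebra.isMulCommutative_adjoin ℤ hc
  have hcoeff : ∀ x y : X, (mulOp x (Finsupp.single one 1)) y = if x = y then 2 else 0 := by
    intro x y
    rw [mulOp_single, mul_one, pairSum_mk]
    simp only [Finsupp.add_apply, Finsupp.single_apply]
    split_ifs <;> rfl
  refine ⟨S, inferInstance, ⟨{
    toFun := fun x => ⟨mulOp x, Algebra.subset_adjoin ⟨x, rfl⟩⟩
    coeff := fun z =>
      { toFun := fun r => ((r : Module.End ℤ (X →₀ ℤ)) (Finsupp.single one 1)) z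
        map_zero' := rfl
        map_add' := fun _ _ => rfl }
    involutive := hinv
    map_one := ?_
    map_mul := fun x y u v h => Subtype.ext (mulOp_mul h)
    coeff_self := fun x => (hcoeff x x).trans (if_pos rfl)
    coeff_ne := fun x y h => (hcoeff x y).trans (if_neg h) }⟩⟩
  refine Subtype.ext (Finsupp.lhom_ext' fun z => LinearMap.ext_ring ?_)
  have h2 : ((2 : S) : Module.End ℤ (X →₀ ℤ)) = 1 + 1 := by
    rw [← one_add_one_eq_two]; rfl
  rw [h2]
  simp only [LinearMap.comp_apply, Finsupp.lsingle_apply, mulOp_single, one_mul, pairSum_mk,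
    LinearMap.add_apply, Module.End.one_apply]

namespace Linearization

variable {X : Type*} [TwoValuedGroup X] {R : Type*} [CommRing R] (M : Linearization X R)

instance : CoeFun (Linearization X R) fun _ => X → R := ⟨toFun⟩

open Classical in
theorem coeff_apply (x y : X) : M.coeff y (M x) = if x = y then 2 else 0 := by
  split_ifs with h
  · rw [h]; exact M.coeff_self y
  · exact M.coeff_ne x y h

theorem exists_mul (x y : X) : ∃ u v, mul x y = s(u, v) ∧ M x * M y = M u + M v := by
  obtain ⟨u, v, h⟩ : ∃ u v, mul x y = s(u, v) := by
    induction hz : mul x y with | _ a b => exact ⟨a, b, rfl⟩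
  exact ⟨u, v, h, M.map_mul _ _ _ _ h⟩

theorem injective {a b : X} (h : M a = M b) : a = b := by
  have h1 := congrArg (M.coeff a) h
  simp only [coeff_apply] at h1
  grind

theorem eq_or_eq_of_add {a b c d : X} (h : M a + M b = M c + M d) :
    (a = c ∧ b = d) ∨ (a = d ∧ b = c) := by
  have h1 := congrArg (M.coeff a) h
  have h2 := congrArg (M.coeff b) h
  simp only [map_add, coeff_apply] at h1 h2
  grind

theorem mul_eq_iff {x y u v : X} : mul x y = s(u, v) ↔ M x * M y = M u + M v := by
  refine ⟨M.map_mul x y u v, fun h => ?_⟩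
  obtain ⟨a, b, h1, h2⟩ := M.exists_mul x y
  rw [h1, Sym2.eq_iff]
  exact M.eq_or_eq_of_add (h2.symm.trans h)

/-- If `u ∈ x * y`, then `y ∈ x * u`. -/
theorem exists_mul_of_mul {x y u v : X} (h : M x * M y = M u + M v) :
    ∃ w, M x * M u = M y + M w := by
  have h1 : u ∈ mul x y := by rw [M.mul_eq_iff.2 h]; exact Sym2.mem_mk_left _ _
  have h2 := mem_mul_of_mem_mul M.involutive (mem_mul_of_mem_mul M.involutive h1)
  obtain ⟨w, hw⟩ := Sym2.mem_iff_exists.1 h2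
  exact ⟨w, by rw [mul_comm, M.mul_eq_iff.1 hw]⟩

theorem exists_sq (x : X) : ∃ y, M x * M x = 2 + M y := by
  have h : (one : X) ∈ mul x x := by
    have := one_mem_mul_inv x
    rwa [M.involutive x] at this
  obtain ⟨w, hw⟩ := Sym2.mem_iff_exists.1 h
  exact ⟨w, by rw [M.mul_eq_iff.1 hw, M.map_one]⟩

theorem eq_of_mul_eq {x y u : X} (h : M x * M y = 2 + M u) : x = y := by
  have h1 : (one : X) ∈ mul x y := by
    rw [M.mul_eq_iff.2 (h.trans (congrArg (· + M u) M.map_one.symm))]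
    exact Sym2.mem_mk_left _ _
  rw [eq_inv_of_one_mem x y (Or.inl h1), M.involutive x]

/-- If `z * p = [p, p]` and `z ≠ e`, then `p ^ 2 = z` and `z ^ 2 = e`. -/
theorem sq_of_mul_eq_self {z p : X} (hz : z ≠ one) (h : M z * M p = M p + M p) :
    M p * M p = 2 + M z ∧ M z * M z = 4 := by
  obtain ⟨w, hw⟩ := M.exists_mul_of_mul ((mul_comm _ _).trans h)
  obtain ⟨s, hs⟩ := M.exists_sq p
  have h1 : M p * M p = 2 + M z := by
    rw [hs, ← M.map_one] at hw ⊢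
    rcases M.eq_or_eq_of_add hw with ⟨h1, h2⟩ | ⟨h1, h2⟩
    · exact absurd h1.symm hz
    · rw [h2]
  exact ⟨h1, by linear_combination 2 * h1 + M p * h - (M z) * h1⟩

end Linearization

/-! ### Lines -/

/-- A `t`-line: a bi-infinite sequence `f` with `t * f k = [f (k - 1), f (k + 1)]`. In a coset group
`A / ι_a` with `t = π a`, the lines are the sequences `k ↦ π (a ^ k * b)`. -/
def IsLine {X : Type*} [TwoValuedGroup X] (t : X) (f : ℤ → X) : Prop :=
  ∀ k, mul t (f k) = s(f (k - 1), f (k + 1))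

/-- The line `n ↦ t ^ |n|` of the powers of `t`. -/
noncomputable def powLine {X : Type*} [TwoValuedGroup X] (t : X) (n : ℤ) : X :=
  pow t n.natAbs

theorem powLine_neg {X : Type*} [TwoValuedGroup X] (t : X) (n : ℤ) :
    powLine t (-n) = powLine t n := by
  simp [powLine]

theorem powLine_one {X : Type*} [TwoValuedGroup X] (t : X) : powLine t 1 = t := rfl

theorem isLine_powLine {X : Type*} [TwoValuedGroup X] (hX : IsInvolutive X) (t : X) :
    IsLine t (powLine t) := by
  have hnat : ∀ n : ℕ, mul t (powLine t (n + 1 : ℕ)) = s(powLine t n, powLine t (n + 2 : ℕ)) :=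
    fun n => mul_pow_succ hX t n
  intro k
  obtain ⟨n, rfl | rfl⟩ := k.eq_nat_or_neg
  · rcases n with _ | n
    · exact mul_one t
    · have := hnat n
      push_cast at this ⊢
      rw [this]
      exact congrArg₂ (fun a b => s(powLine t a, powLine t b)) (by ring) (by ring)
  · rcases n with _ | n
    · exact mul_one t
    · have := hnat n
      rw [powLine_neg, this, Sym2.eq_swap, ← powLine_neg t n, ← powLine_neg t (n + 2 : ℕ)]
      push_cast
      exact congrArg₂ (fun a b => s(powLine t a, powLine t b)) (by ring) (by ring)

theorem IsLine.comp_neg {X : Type*} [TwoValuedGroup X] {t : X} {f : ℤ → X} (hf : IsLine t f) :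
    IsLine t fun k => f (-k) := by
  intro k
  rw [hf (-k), Sym2.eq_swap]
  exact congrArg₂ (fun a b => s(f a, f b)) (by ring) (by ring)

theorem IsLine.comp_add {X : Type*} [TwoValuedGroup X] {t : X} {f : ℤ → X} (hf : IsLine t f)
    (n : ℤ) : IsLine t fun k => f (k + n) := by
  intro k
  rw [hf (k + n)]
  exact congrArg₂ (fun a b => s(f a, f b)) (by ring) (by ring)

/-- Two lines that agree at two consecutive places are equal. -/
theorem IsLine.ext {X : Type*} [TwoValuedGroup X] {t : X} {f g : ℤ → X} (hf : IsLine t f)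
    (hg : IsLine t g) (h0 : f 0 = g 0) (h1 : f 1 = g 1) : f = g := by
  have key : ∀ k : ℤ, f k = g k ∧ f (k + 1) = g (k + 1) := by
    intro k
    induction k with
    | zero => exact ⟨h0, h1⟩
    | succ n ih =>
      refine ⟨ih.2, ?_⟩
      have h2 := hf (n + 1)
      rw [ih.2, hg (n + 1), add_sub_cancel_right, ih.1] at h2
      exact (Sym2.congr_right.1 h2).symm
    | pred n ih =>
      rw [sub_add_cancel]
      refine ⟨?_, ih.1⟩
      have h2 := hf (-n)
      rw [ih.1, hg (-n), ih.2] at h2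
      exact (Sym2.congr_left.1 h2).symm
  exact funext fun k => (key k).1

namespace Linearization

variable {X : Type*} [TwoValuedGroup X] {R : Type*} [CommRing R] (M : Linearization X R)

theorem isLine_iff {t : X} {f : ℤ → X} :
    IsLine t f ↔ ∀ k, M t * M (f k) = M (f (k - 1)) + M (f (k + 1)) :=
  forall_congr' fun _ => M.mul_eq_iff

theorem mem_of_add_three {a b c d e f : X}
    (h : M a + M b + M c = M d + M e + M f) : a = d ∨ a = e ∨ a = f := by
  have h1 := congrArg (M.coeff a) h
  simp only [map_add, coeff_apply] at h1
  grind

theorem mem_of_add_four {a b c d a' b' c' d' : X}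
    (h : M a + M b + (M c + M d) = M a' + M b' + (M c' + M d')) :
    a = a' ∨ a = b' ∨ a = c' ∨ a = d' := by
  have h1 := congrArg (M.coeff a) h
  simp only [map_add, coeff_apply] at h1
  grind

/-- If two two-element multisets are disjoint, then the positive part of their difference is the
first of them. -/
theorem add_eq_add_of_disjoint {a b c d a' b' c' d' : X}
    (h : M a + M b + (M c + M d) = M a' + M b' + (M c' + M d'))
    (h1 : a ≠ c') (h2 : a ≠ d') (h3 : b ≠ c') (h4 : b ≠ d') : M a + M b = M a' + M b' := by
  rcases M.mem_of_add_four h with e | e | e | e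
  · subst e
    have h' : M b + M c + M d = M b' + M c' + M d' := by linear_combination h
    rcases M.mem_of_add_three h' with e | e | e
    · rw [e]
    · exact absurd e h3
    · exact absurd e h4
  · subst e
    have h' : M b + M c + M d = M a' + M c' + M d' := by linear_combination h
    rcases M.mem_of_add_three h' with e | e | e
    · rw [e, add_comm]
    · exact absurd e h3
    · exact absurd e h4
  · exact absurd e h1
  · exact absurd e h2

/-- The power `t ^ |d|` shifts a line by `d` in both directions. -/
theorem line_mul {t : X} {f : ℤ → X} (hf : IsLine t f) {d k a b : ℤ} (ha : a = k + d)
    (hb : b = k - d) : M (powLine t d) * M (f k) = M (f a) + M (f b) := by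
  have hnat : ∀ n : ℕ, ∀ k : ℤ, M (powLine t n) * M (f k) = M (f (k + n)) + M (f (k - n)) := by
    intro n
    induction n using Nat.twoStepInduction with
    | zero =>
      intro k
      have : M (powLine t (0 : ℕ)) = 2 := M.map_one
      rw [this]
      push_cast
      rw [add_zero, sub_zero]
      ring
    | one =>
      intro k
      have := M.isLine_iff.1 hf k
      have e : powLine t (1 : ℕ) = t := rfl
      rw [e, this]
      push_cast
      ring
    | more n ih1 ih2 =>
      intro k
      have h1 := M.isLine_iff.1 (isLine_powLine M.involutive t) (n + 1)
      have h2 := ih1 k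
      have h3 := ih2 k
      have h4 := M.isLine_iff.1 hf (k + (n + 1))
      have h5 := M.isLine_iff.1 hf (k - (n + 1))
      push_cast at h2 h3 ⊢
      rw [show (n : ℤ) + 1 - 1 = n by ring, show (n : ℤ) + 1 + 1 = n + 2 by ring] at h1
      rw [show k + ((n : ℤ) + 1) - 1 = k + n by ring,
        show k + ((n : ℤ) + 1) + 1 = k + (n + 2) by ring] at h4
      rw [show k - ((n : ℤ) + 1) - 1 = k - (n + 2) by ring,
        show k - ((n : ℤ) + 1) + 1 = k - n by ring] at h5
      linear_combination h4 + h5 + M t * h3 - h2 - M (f k) * h1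
  subst ha hb
  obtain ⟨n, rfl | rfl⟩ := d.eq_nat_or_neg
  · exact hnat n k
  · rw [powLine_neg, hnat n k, sub_neg_eq_add, add_comm]
    rfl

theorem line_step {t : X} {f : ℤ → X} (hf : IsLine t f) {k a b : ℤ} (ha : a = k + 1)
    (hb : b = k - 1) : M t * M (f k) = M (f a) + M (f b) :=
  M.line_mul (d := 1) hf ha hb

theorem powLine_mul_powLine (t : X) {d k a b : ℤ} (ha : a = k + d) (hb : b = k - d) :
    M (powLine t d) * M (powLine t k) = M (powLine t a) + M (powLine t b) :=
  M.line_mul (isLine_powLine M.involutive t) ha hb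

theorem map_powLine_zero (t : X) : M (powLine t 0) = 2 := M.map_one

/-- Multiplication by `t ^ 2` has no fixed points: this is where `t ^ 4 ≠ e` enters. -/
theorem powLine_two_mul_ne {t : X} (h2 : powLine t 2 ≠ one) (h4 : powLine t 4 ≠ one) (p : X) :
    M (powLine t 2) * M p ≠ M p + M p := by
  intro h
  have h1 := (M.sq_of_mul_eq_self h2 h).2
  have h3 := M.powLine_mul_powLine t (d := 2) (k := 2) (a := 4) (b := 0) rfl rfl
  refine h4 (M.injective ?_)
  rw [M.map_powLine_zero] at h3
  rw [M.map_one]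
  linear_combination h1 - h3

/-- The element `t ^ 2 - e` of the linearization does not annihilate a difference `p - q` of
distinct elements. -/
theorem eq_of_powLine_two_mul {t : X} (h2 : powLine t 2 ≠ one) (h4 : powLine t 4 ≠ one) {p q : X}
    (h : (M (powLine t 2) - 2) * (M p - M q) = 0) : p = q := by
  by_contra hpq
  obtain ⟨a, b, -, hab⟩ := M.exists_mul (powLine t 2) p
  obtain ⟨c, d, -, hcd⟩ := M.exists_mul (powLine t 2) q
  refine M.powLine_two_mul_ne h2 h4 p (hab.trans (Eq.symm ?_))
  have e : M p + M p + (M c + M d) = M a + M b + (M q + M q) := by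
    linear_combination hab - hcd - h
  exact M.add_eq_add_of_disjoint e hpq hpq hpq hpq

/-- A line is not constant on a parity class. -/
theorem line_not_const (M : Linearization X R) {t : X} (h2 : powLine t 2 ≠ one)
    (h4 : powLine t 4 ≠ one) {f : ℤ → X} (hf : IsLine t f) (k : ℤ) (p : X) : ¬ ∀ i, f (k + 2 * i) = p := by
  intro h
  have h1 := M.line_mul (d := 2) (k := k) hf rfl rfl
  have e0 := h 0
  have e1 := h 1
  have e2 := h (-1)
  rw [show k + 2 * 0 = k by ring] at e0
  rw [show k + 2 * 1 = k + 2 by ring] at e1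
  rw [show k + 2 * -1 = k - 2 by ring] at e2
  rw [e0, e1, e2] at h1
  exact M.powLine_two_mul_ne h2 h4 p h1

/-- A family of two-element multisets that is additive in two indices does not depend on one of
them, or splits off an element for each of them. -/
theorem exists_splitting {I J : Type*} (S : I → J → R) (hS : ∀ i j, ∃ a b, S i j = M a + M b)
    (hadd : ∀ i i' j j', S i j + S i' j' = S i j' + S i' j)
    (hi : ¬ ∀ i i' j, S i j = S i' j) (hj : ¬ ∀ i j j', S i j = S i j') :
    ∃ (h : I → X) (w : J → X), (∀ i j, S i j = M (h i) + M (w j)) ∧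
      (¬ ∃ p, ∀ i, h i = p) ∧ ¬ ∃ p, ∀ j, w j = p := by
  suffices ∃ (h : I → X) (w : J → X), ∀ i j, S i j = M (h i) + M (w j) by
    obtain ⟨h, w, H⟩ := this
    refine ⟨h, w, H, ?_, ?_⟩
    · rintro ⟨p, hp⟩
      exact hi fun i i' j => by rw [H, H, hp, hp]
    · rintro ⟨p, hp⟩
      exact hj fun i j j' => by rw [H, H, hp, hp]
  push Not at hi hj
  obtain ⟨i₁, i₂, j₀, hi⟩ := hi
  obtain ⟨i₀, j₁, j₂, hj⟩ := hj
  have hi' : S i₁ j₁ ≠ S i₂ j₁ := fun e => hi (by linear_combination hadd i₁ i₂ j₀ j₁ + e)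
  have hj' : S i₁ j₁ ≠ S i₁ j₂ := fun e => hj (by linear_combination hadd i₀ i₁ j₁ j₂ + e)
  obtain ⟨p, q, q', h1, h2⟩ : ∃ p q q', S i₁ j₁ = M p + M q ∧ S i₁ j₂ = M p + M q' := by
    obtain ⟨a, b, hab⟩ := hS i₁ j₁
    obtain ⟨c, d, hcd⟩ := hS i₁ j₂
    obtain ⟨a', b', hab'⟩ := hS i₂ j₁
    obtain ⟨c', d', hcd'⟩ := hS i₂ j₂
    by_contra! hne
    have e : M a + M b + (M c' + M d') = M a' + M b' + (M c + M d) := by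
      rw [← hab, ← hcd, ← hab', ← hcd']
      linear_combination hadd i₁ i₂ j₁ j₂
    refine hi' (hab.trans ((M.add_eq_add_of_disjoint e ?_ ?_ ?_ ?_).trans hab'.symm))
    · rintro rfl; exact hne a b d hab hcd
    · rintro rfl; exact hne a b c hab (hcd.trans (add_comm _ _))
    · rintro rfl; exact hne b a d (hab.trans (add_comm _ _)) hcd
    · rintro rfl; exact hne b a c (hab.trans (add_comm _ _)) (hcd.trans (add_comm _ _))
  have hq : q ≠ q' := by rintro rfl; exact hj' (h1.trans h2.symm)
  have hh : ∀ i, ∃ x, S i j₁ = M x + M q := by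
    intro i
    obtain ⟨a, b, hab⟩ := hS i j₁
    obtain ⟨c, d, hcd⟩ := hS i j₂
    have e : M q + M c + M d = M a + M b + M q' := by
      linear_combination hab - hcd - hadd i i₁ j₁ j₂ - h1 + h2
    rcases M.mem_of_add_three e with rfl | rfl | e
    · exact ⟨b, by rw [hab, add_comm]⟩
    · exact ⟨a, hab⟩
    · exact absurd e hq
  choose h hh using hh
  have hw : ∀ j, ∃ y, S i₁ j = M (h i₁) + M y := by
    intro j
    obtain ⟨a, b, hab⟩ := hS i₁ j
    obtain ⟨c, d, hcd⟩ := hS i₂ j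
    have e : M (h i₁) + M c + M d = M a + M b + M (h i₂) := by
      linear_combination hab - hcd + hadd i₁ i₂ j₁ j - hh i₁ + hh i₂
    rcases M.mem_of_add_three e with e | e | e
    · exact ⟨b, by rw [hab, e]⟩
    · exact ⟨a, by rw [hab, e, add_comm]⟩
    · exact absurd (by rw [hh i₁, hh i₂, e]) hi'
  choose w hw using hw
  exact ⟨h, w, fun i j => by linear_combination hadd i i₁ j j₁ + hh i + hw j - hh i₁⟩

/-- The d'Alembert equation in characteristic coordinates: products of two lines are additive in
the sum and the difference of the indices. -/
theorem line_mul_line_additive {t : X} {f g : ℤ → X} (hf : IsLine t f) (hg : IsLine t g)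
    (i i' j j' : ℤ) :
    M (f (i + j)) * M (g (i - j)) + M (f (i' + j')) * M (g (i' - j')) =
      M (f (i + j')) * M (g (i - j')) + M (f (i' + j)) * M (g (i' - j)) := by
  have const : ∀ φ : ℤ → R, (∀ k, φ (k + 1) = φ k) → ∀ k, φ k = φ 0 := by
    intro φ h k
    induction k with
    | zero => rfl
    | succ n ih => rw [h, ih]
    | pred n ih => rw [← ih, ← h (-n - 1), sub_add_cancel]
  set S : ℤ → ℤ → R := fun i j => M (f (i + j)) * M (g (i - j)) with hS
  have hstep : ∀ i j, S (i + 1) (j + 1) + S i j = S (i + 1) j + S i (j + 1) := by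
    intro i j
    have h1 := M.line_step hf (k := i + j + 1) (a := i + 1 + (j + 1)) (b := i + j)
      (by ring) (by ring)
    have h2 := M.line_step hg (k := i - j) (a := i + 1 - j) (b := i - (j + 1)) (by ring) (by ring)
    simp only [hS]
    rw [show i + 1 - (j + 1) = i - j by ring, show i + 1 + j = i + j + 1 by ring,
      show i + (j + 1) = i + j + 1 by ring] at *
    linear_combination M (f (i + j + 1)) * h2 - M (g (i - j)) * h1
  have h1 : ∀ i j, S i (j + 1) - S i j = S 0 (j + 1) - S 0 j := fun i j =>
    const (fun i => S i (j + 1) - S i j) (fun k => by linear_combination hstep k j) i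
  have h2 : ∀ i j, S i j - S 0 j = S i 0 - S 0 0 := fun i j =>
    const (fun j => S i j - S 0 j) (fun k => by linear_combination h1 i k) j
  change S i j + S i' j' = S i j' + S i' j
  linear_combination h2 i j + h2 i' j' - h2 i j' - h2 i' j

/-! ### Products of two lines -/

/-- If `f (k + 4) = f k`, then `t ^ 4` fixes every element of the line. -/
theorem powLine_four_mul_of_periodic {t : X} {f : ℤ → X} (hf : IsLine t f)
    (hper : ∀ a, f (a + 4) = f a) (a : ℤ) : M (powLine t 4) * M (f a) = M (f a) + M (f a) := by
  have h := M.line_mul (d := 4) (k := a) hf rfl rfl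
  have e := hper (a - 4)
  rw [sub_add_cancel] at e
  rwa [hper, ← e] at h

theorem add_eq_of_add_eq_four {α β γ δ y : X}
    (h : M α + M β + (M γ + M δ) = M y + M y + (M y + M y)) : M α + M β = M y + M y := by
  have h' : M β + M α + (M γ + M δ) = M y + M y + (M y + M y) := by linear_combination h
  have h1 : α = y := by simpa using M.mem_of_add_four h
  have h2 : β = y := by simpa using M.mem_of_add_four h'
  rw [h1, h2]

/-- The combinatorial end of `self_product_not_degenerate`: an equality of six-element multisets
that involves the identity. -/
theorem cases_of_sq_eq {u q r s v : X} (hu : u ≠ one)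
    (h : M u + M r + (M q + M q) = M s + M s + (M one + M v)) :
    (q = one ∧ s = one) ∨ (q = one ∧ s = u) ∨ (q = s ∧ v = u ∧ r = one) := by
  have k1 := congrArg (M.coeff one) h
  have k2 := congrArg (M.coeff s) h
  have k3 := congrArg (M.coeff q) h
  simp only [map_add, coeff_apply] at k1 k2 k3
  by_cases hq : q = one
  · subst hq
    grind
  · have hs : q = s := by grind
    subst hs
    have h' : M u + M r = M one + M v := by linear_combination h
    rcases M.eq_or_eq_of_add h' with e | e
    · exact absurd e.1 hu
    · exact Or.inr (Or.inr ⟨rfl, e.1.symm, e.2⟩)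

/-- The products `f k * f l` of a line with itself do not depend on the difference `k - l` alone:
otherwise all the squares `f k ^ 2` agree with one element `s`, and comparing products of four
elements of the line leads to `t ^ 2 = e`, to `t ^ 4 = e`, or to a line of period four. -/
theorem self_product_not_degenerate {t : X} (h2 : powLine t 2 ≠ one) (h4 : powLine t 4 ≠ one)
    {f : ℤ → X} (hf : IsLine t f) :
    ¬ ∀ i i' j, M (f (i + j)) * M (f (i - j)) = M (f (i' + j)) * M (f (i' - j)) := by
  intro H
  have hT := M.powLine_mul_powLine t (d := 2) (k := 2) (a := 4) (b := 0) rfl rfl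
  rw [M.map_powLine_zero] at hT
  have hT4 : M (powLine t 4) ≠ 2 := fun e => h4 (M.injective (e.trans M.map_one.symm))
  obtain ⟨s, hs⟩ := M.exists_sq (f 0)
  -- the products `f k * f (k - 2)` all equal `[t ^ 2, r]`, where `t ^ 2 * s = [r, r]`
  obtain ⟨r, hF1, hTs⟩ : ∃ r, M (f 2) * M (f 0) = M (powLine t 2) + M r ∧
      M (powLine t 2) * M s = M r + M r := by
    obtain ⟨a, b, -, hab⟩ := M.exists_mul (f 2) (f 0)
    obtain ⟨c, d, -, hcd⟩ := M.exists_mul (powLine t 2) s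
    have e1 := M.line_mul (d := 2) (k := 0) (a := 2) (b := -2) hf rfl rfl
    have e2 := H 1 (-1) 1
    norm_num at e2
    have e3 : M (powLine t 2) + M (powLine t 2) + (M c + M d) = M a + M b + (M a + M b) := by
      linear_combination -hcd - M (powLine t 2) * hs + M (f 0) * e1 + 2 * hab - e2
    have e4 : powLine t 2 = a ∨ powLine t 2 = b := by
      have := M.mem_of_add_four e3
      tauto
    rcases e4 with e | e
    · refine ⟨b, by rw [hab, e], ?_⟩
      rw [← e] at e3
      linear_combination hcd + e3
    · refine ⟨a, by rw [hab, e, add_comm], ?_⟩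
      rw [← e] at e3
      linear_combination hcd + e3
  obtain ⟨q, hTr⟩ := M.exists_mul_of_mul hTs
  obtain ⟨r2, hr2⟩ := M.exists_sq r
  obtain ⟨s2, hs2⟩ := M.exists_sq s
  have hsq : ∀ i, M (f i) * M (f i) = 2 + M s := fun i => by
    have := H i 0 0
    simp only [add_zero, sub_zero] at this
    rw [this, hs]
  have hF1' : ∀ i, M (f (i + 2)) * M (f i) = M (powLine t 2) + M r := fun i => by
    have := H (i + 1) 1 1
    rw [show i + 1 + 1 = i + 2 by ring, add_sub_cancel_right] at this
    norm_num at this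
    rw [this, hF1]
  have hF2 : ∀ i, M (f (i + 2)) * M (f (i - 2)) = M (powLine t 4) + M q := fun i => by
    have e1 := M.line_mul (d := 2) (k := i) (a := i + 2) (b := i - 2) hf rfl rfl
    have e2 := hF1' (i - 2)
    rw [sub_add_cancel] at e2
    linear_combination M (powLine t 2) * e2 - M (f (i - 2)) * e1 + hTr + hT - hsq (i - 2)
  -- comparing `(f 0 * f 2) * (f 0 * f 2)` with `(f 0 * f 0) * (f 2 * f 2)`
  have key : M (powLine t 4) + M r2 + (M q + M q) = M s + M s + (M one + M s2) := by
    have e1 := hsq 2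
    rw [M.map_one]
    linear_combination M (f 2) * M (f 2) * hs + (2 + M s) * e1 + hs2 - hr2 - hT - 2 * hTr -
      (M (f 2) * M (f 0) + M (powLine t 2) + M r) * hF1
  rcases M.cases_of_sq_eq h4 key with ⟨rfl, rfl⟩ | ⟨rfl, rfl⟩ | ⟨rfl, rfl, rfl⟩
  · rw [M.map_one] at hTs hTr
    have e : powLine t 2 = r := by
      have := M.eq_or_eq_of_add ((mul_two _).symm.trans hTs)
      tauto
    rw [← e] at hTr
    exact hT4 (by linear_combination hTr - hT)
  · rw [M.map_one] at hTr hF2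
    have e : powLine t 2 = r := M.eq_of_mul_eq (hTr.trans (add_comm _ _))
    have hper : ∀ i, f (i + 4) = f i := fun i => by
      have := M.eq_of_mul_eq ((hF2 (i + 2)).trans (add_comm _ _))
      rwa [add_sub_cancel_right, show i + 2 + 2 = i + 4 by ring] at this
    -- `f 0 * f 1` contains an odd power `t ^ d` with `d = 1, 3, 5`, which multiplies `f 1` to
    -- `[f 0, f 2]` on the one hand and to `[f 0, f 0]` on the other hand
    obtain ⟨p, p', -, hp⟩ := M.exists_mul (f 0) (f 1)
    obtain ⟨x, y, -, hxy⟩ := M.exists_mul (f 0) (f (-1))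
    have e1 := M.line_step hf (k := 0) (a := 1) (b := -1) rfl rfl
    have e2 := M.powLine_mul_powLine t (d := 1) (k := 4) (a := 5) (b := 3) rfl rfl
    rw [powLine_one] at e2
    have e3 : M p + M p' + (M x + M y) =
        M t + M t + (M (powLine t 5) + M (powLine t 3)) := by
      linear_combination -hp - hxy - M (f 0) * e1 + M t * hs + e2
    have p0 : f 4 = f 0 := hper 0
    have p1 : f (-2) = f 2 := (hper (-2)).symm
    have p2 : f 6 = f 2 := hper 2
    have p3 : f (-4) = f 0 := (hper (-4)).symm
    have e4 : M p * M (f 1) = M (f 2) + M (f 0) := by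
      have d1 := M.line_mul (d := 1) (k := 1) (a := 2) (b := 0) hf rfl rfl
      have d3 := M.line_mul (d := 3) (k := 1) (a := 4) (b := -2) hf rfl rfl
      have d5 := M.line_mul (d := 5) (k := 1) (a := 6) (b := -4) hf rfl rfl
      rw [p0, p1, add_comm] at d3
      rw [p2, p3] at d5
      rcases M.mem_of_add_four e3 with e | e | e | e <;> rw [e] <;> assumption
    obtain ⟨α, β, -, hαβ⟩ := M.exists_mul p' (f 1)
    have e5 := M.powLine_four_mul_of_periodic hf hper 0
    have e6 : M (f 2) + M (f 0) = M (f 0) + M (f 0) := by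
      refine M.add_eq_of_add_eq_four (γ := α) (δ := β) ?_
      linear_combination -e4 - hαβ - M (f 1) * hp + M (f 0) * hsq 1 + e5
    have e7 : f 2 = f 0 := M.injective (add_right_cancel e6)
    rw [e7, hs, ← e, ← M.map_one] at hF1
    exact h2 (by have := M.eq_or_eq_of_add hF1; tauto)
  · -- here `r * r = [e, e]`, and `r * f i` contains `f (i + 2)` and `f (i - 2)`, which coincide
    rw [M.map_one] at hr2
    have hr : ∀ i, ∃ z, M (f (i + 2)) * M r = M (f i) + M z := fun i =>
      M.exists_mul_of_mul ((hF1' i).trans (add_comm _ _))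
    have hr' : ∀ i, M r * M (f i) = M (f (i + 2)) + M (f (i + 2)) := fun i => by
      obtain ⟨z, hz⟩ := hr i
      obtain ⟨a, b, -, hab⟩ := M.exists_mul r (f i)
      obtain ⟨c, d, -, hcd⟩ := M.exists_mul r z
      rw [hab]
      refine M.add_eq_of_add_eq_four (γ := c) (δ := d) ?_
      linear_combination -hab - hcd - M r * hz + M (f (i + 2)) * hr2
    have hper : ∀ i, f (i + 4) = f i := fun i => by
      obtain ⟨z, hz⟩ := hr i
      have e1 := hr' (i + 2)
      rw [mul_comm, hz, show i + 2 + 2 = i + 4 by ring] at e1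
      have := M.eq_or_eq_of_add e1
      tauto
    obtain ⟨e1, e2⟩ := M.sq_of_mul_eq_self h4 (M.powLine_four_mul_of_periodic hf hper 0)
    have e3 : M q = M (powLine t 4) := by linear_combination e1 - hs
    rw [e3] at hs2
    exact hT4 (by linear_combination e2 - hs2)

/-- The product of a line with itself, on indices of equal parity. -/
theorem exists_self_product {t : X} (h2 : powLine t 2 ≠ one) (h4 : powLine t 4 ≠ one)
    {f : ℤ → X} (hf : IsLine t f) :
    ∃ h : ℤ → X, (∀ i j, M (f (i + j)) * M (f (i - j)) = M (h i) + M (powLine t (2 * j))) ∧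
      ¬ ∃ p, ∀ i, h i = p := by
  obtain ⟨h, w, H, hh, -⟩ := M.exists_splitting (fun i j => M (f (i + j)) * M (f (i - j)))
    (fun i j => by obtain ⟨a, b, -, hab⟩ := M.exists_mul (f (i + j)) (f (i - j)); exact ⟨a, b, hab⟩)
    (M.line_mul_line_additive hf hf) (M.self_product_not_degenerate h2 h4 hf) (by
      intro H
      -- if the products depend on the sum of the indices only, then `f (i + 1) = f (i - 1)`
      refine M.line_not_const h2 h4 hf 0 (f 0) fun i => ?_
      have hstep : ∀ i, f (i + 1) = f (i - 1) := fun i => by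
        have e := H i 1 0
        obtain ⟨s, hs⟩ := M.exists_sq (f i)
        simp only [add_zero, sub_zero, hs] at e
        exact M.eq_of_mul_eq e
      have hstep' : ∀ i, f (i + 2) = f i := fun i => by
        have := hstep (i + 1)
        rwa [add_sub_cancel_right, show i + 1 + 1 = i + 2 by ring] at this
      induction i with
      | zero => rfl
      | succ n ih => rw [← ih, ← hstep' (0 + 2 * n)]; exact congrArg f (by ring)
      | pred n ih => rw [← ih, ← hstep' (0 + 2 * (-n - 1))]; exact congrArg f (by ring))
  have hw0 : w 0 = one := by
    by_contra hne
    refine hh ⟨one, fun i => ?_⟩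
    obtain ⟨s, hs⟩ := M.exists_sq (f i)
    have e := H i 0
    simp only [add_zero, sub_zero] at e
    rw [hs, ← M.map_one] at e
    rcases M.eq_or_eq_of_add e with e | e
    · exact e.1.symm
    · exact absurd e.1.symm hne
  have hstep : ∀ i j, M (powLine t 2) * (M (h i) + M (w j)) =
      M (h (i + 1)) + M (w (j + 1)) + (M (h (i - 1)) + M (w (j - 1))) := fun i j => by
    have e := M.line_mul (d := 2) (k := i + j) (a := i + 1 + (j + 1)) (b := i - 1 + (j - 1)) hf
      (by ring) (by ring)
    have e1 := H (i + 1) (j + 1)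
    have e2 := H (i - 1) (j - 1)
    have e0 := H i j
    rw [show i + 1 - (j + 1) = i - j by ring] at e1
    rw [show i - 1 - (j - 1) = i - j by ring] at e2
    linear_combination e1 + e2 - M (powLine t 2) * e0 + M (f (i - j)) * e
  have hw1 : w (-1) = w 1 := M.injective (by
    have e1 := H 0 1
    have e2 := H 0 (-1)
    norm_num at e1 e2
    linear_combination e1 - e2)
  -- if `w 1` were not `t ^ 2`, then `[h (i + 1), h (i - 1)]` would be `[t ^ 2, t ^ 2]` for all `i`
  have hw2 : w 1 = powLine t 2 := by
    by_contra hne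
    refine hh ⟨powLine t 2, fun i => ?_⟩
    obtain ⟨a, b, -, hab⟩ := M.exists_mul (powLine t 2) (h (i - 1))
    have e := hstep (i - 1) 0
    rw [hw0, zero_add, zero_sub, hw1, sub_add_cancel, M.map_one] at e
    have e' : M (powLine t 2) + M (powLine t 2) + (M a + M b) =
        M (w 1) + M (w 1) + (M (h i) + M (h (i - 1 - 1))) := by linear_combination e - hab
    have e'' : M (powLine t 2) + M (powLine t 2) + (M (w 1) + M (w 1)) =
        M (h i) + M (h (i - 1 - 1)) + (M (w 1) + M (w 1)) →
        h i = powLine t 2 := fun h' => by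
      have := M.eq_or_eq_of_add (add_right_cancel h')
      tauto
    have k1 := congrArg (M.coeff (powLine t 2)) e'
    simp only [map_add, coeff_apply] at k1
    grind
  have hwstep : ∀ j, M (powLine t 2) * M (w j) = M (w (j + 1)) + M (w (j - 1)) := fun j => by
    have e0 := hstep 0 0
    have e1 := hstep 0 j
    rw [hw0, zero_add, zero_sub, hw1, hw2, M.map_one] at e0
    rw [zero_add, zero_sub] at e1
    linear_combination e1 - e0
  have hw : ∀ j : ℤ, w j = powLine t (2 * j) ∧ w (j + 1) = powLine t (2 * (j + 1)) := by
    intro j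
    induction j with
    | zero => exact ⟨hw0, hw2⟩
    | succ n ih =>
      refine ⟨ih.2, M.injective ?_⟩
      have e1 := hwstep (n + 1)
      have e2 := M.powLine_mul_powLine t (d := 2) (k := 2 * (n + 1)) (a := 2 * (n + 1 + 1))
        (b := 2 * n) (by ring) (by ring)
      rw [add_sub_cancel_right, ih.1, ih.2] at e1
      linear_combination e2 - e1
    | pred n ih =>
      rw [sub_add_cancel]
      refine ⟨M.injective ?_, ih.1⟩
      have e1 := hwstep (-n)
      have e2 := M.powLine_mul_powLine t (d := 2) (k := 2 * -n) (a := 2 * (-n + 1))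
        (b := 2 * (-n - 1)) (by ring) (by ring)
      rw [ih.1, ih.2] at e1
      linear_combination e2 - e1
  exact ⟨h, fun i j => by rw [H i j, (hw j).1], hh⟩

/-- A line of period four would have the constant square `t ^ 4`. -/
theorem line_not_periodic_four (M : Linearization X R) {t : X} (h2 : powLine t 2 ≠ one)
    (h4 : powLine t 4 ≠ one) {f : ℤ → X} (hf : IsLine t f) : ¬ ∀ a, f (a + 4) = f a := by
  intro hper
  obtain ⟨h, H, hh⟩ := M.exists_self_product h2 h4 hf
  refine hh ⟨powLine t 4, fun i => M.injective ?_⟩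
  have e1 := (M.sq_of_mul_eq_self h4 (M.powLine_four_mul_of_periodic hf hper i)).1
  have e2 := H i 0
  simp only [add_zero, sub_zero, mul_zero, M.map_powLine_zero] at e2
  linear_combination e1 - e2

/-- The products `f k * g l` of two lines do not depend on `k - l` alone, for `k` and `l` of equal
parity: expanding products of two elements of `f` and one of `g` in two ways shows that `g` would
have period four. -/
theorem product_not_degenerate {t : X} (h2 : powLine t 2 ≠ one) (h4 : powLine t 4 ≠ one)
    {f g : ℤ → X} (hf : IsLine t f) (hg : IsLine t g) :
    ¬ ∀ i i' j, M (f (i + j)) * M (g (i - j)) = M (f (i' + j)) * M (g (i' - j)) := by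
  intro H
  obtain ⟨h, hh, -⟩ := M.exists_self_product h2 h4 hf
  have hfg : ∀ m l, M (f (m + 2 * l)) * M (g m) = M (f (m + 2 * l + 2)) * M (g (m + 2)) := by
    intro m l
    have := H (m + l) (m + l + 2) l
    convert this using 4 <;> ring
  -- `f m * f m * g m = f m * f (m + 2) * g (m + 2)` and
  -- `f (m - 2) * f (m + 2) * g m = f (m - 2) * f (m + 4) * g (m + 2)`
  have key : ∀ m, M (g m) + M (g (m + 8)) = M (g (m + 4)) + M (g (m + 4)) := by
    intro m
    have a1 := hh m 0
    have a2 := hh (m + 1) 1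
    have a3 := hh m 2
    have a4 := hh (m + 1) 3
    have b1 := hfg m 0
    have b2 := hfg m 1
    have c1 := M.line_mul (d := 2) (k := m + 2) (a := m + 4) (b := m) hg (by ring) (by ring)
    have c2 := M.line_mul (d := 4) (k := m) (a := m + 4) (b := m - 4) hg (by ring) (by ring)
    have c3 := M.line_mul (d := 6) (k := m + 2) (a := m + 8) (b := m - 4) hg (by ring) (by ring)
    rw [show m + 1 + 1 = m + 2 by ring, show m + 1 - 1 = m by ring,
      show (2 : ℤ) * 1 = 2 by rfl] at a2
    rw [show m + 1 + 3 = m + 4 by ring, show m + 1 - 3 = m - 2 by ring,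
      show (2 : ℤ) * 3 = 6 by rfl] at a4
    rw [show (2 : ℤ) * 2 = 4 by rfl] at a3
    rw [show m + 2 * 1 + 2 = m + 4 by ring, show m + 2 * 1 = m + 2 by ring] at b2
    simp only [mul_zero, add_zero, sub_zero, M.map_powLine_zero] at a1 b1
    linear_combination M (f m) * b1 - M (g m) * a1 + M (g (m + 2)) * a2 + c1 -
      M (f (m - 2)) * b2 + M (g m) * a3 + c2 - M (g (m + 2)) * a4 - c3
  refine M.line_not_periodic_four h2 h4 hg fun a => ?_
  have := M.eq_or_eq_of_add (key a)
  rcases this with h | h <;> exact h.1.symm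

/-- On indices of equal parity, the product of two lines splits into a function of the sum and a
function of the difference of the indices. -/
theorem exists_product_of_even {t : X} (h2 : powLine t 2 ≠ one) (h4 : powLine t 4 ≠ one)
    {f g : ℤ → X} (hf : IsLine t f) (hg : IsLine t g) :
    ∃ h w : ℤ → X, (∀ i j, M (f (i + j)) * M (g (i - j)) = M (h i) + M (w j)) ∧
      (¬ ∃ p, ∀ i, h i = p) ∧ ¬ ∃ p, ∀ j, w j = p := by
  refine M.exists_splitting (fun i j => M (f (i + j)) * M (g (i - j)))
    (fun i j => by obtain ⟨a, b, -, hab⟩ := M.exists_mul (f (i + j)) (g (i - j)); exact ⟨a, b, hab⟩)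
    (M.line_mul_line_additive hf hg) (M.product_not_degenerate h2 h4 hf hg) fun H => ?_
  refine M.product_not_degenerate h2 h4 hf hg.comp_neg fun i i' j => ?_
  have := H j i i'
  rwa [add_comm j i, add_comm j i', ← neg_sub i j, ← neg_sub i' j] at this

/-- The products of two lines split, for all indices: the two parity classes are split separately. -/
theorem exists_product {t : X} (h2 : powLine t 2 ≠ one) (h4 : powLine t 4 ≠ one)
    {f g : ℤ → X} (hf : IsLine t f) (hg : IsLine t g) :
    ∃ h w : ℤ → X, (∀ k l, M (f k) * M (g l) = M (h (k + l)) + M (w (k - l))) ∧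
      (∀ k p, ¬ ∀ i, h (k + 2 * i) = p) ∧ ∀ k p, ¬ ∀ i, w (k + 2 * i) = p := by
  obtain ⟨h₀, w₀, H₀, hh₀, hw₀⟩ := M.exists_product_of_even h2 h4 hf hg
  obtain ⟨h₁, w₁, H₁, hh₁, hw₁⟩ := M.exists_product_of_even h2 h4 (hf.comp_add 1) hg
  have glue : ∀ a b : ℤ → X, (¬ ∃ p, ∀ i, a i = p) → (¬ ∃ p, ∀ i, b i = p) →
      ∀ k p, ¬ ∀ i, (fun n : ℤ => if n % 2 = 0 then a (n / 2) else b (n / 2)) (k + 2 * i) = p := by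
    intro a b ha hb k p H
    rcases Int.emod_two_eq_zero_or_one k with hk | hk
    · refine ha ⟨p, fun i => ?_⟩
      have e := H (i - k / 2)
      simp only at e
      rwa [if_pos (by omega), show (k + 2 * (i - k / 2)) / 2 = i by omega] at e
    · refine hb ⟨p, fun i => ?_⟩
      have e := H (i - k / 2)
      simp only at e
      rwa [if_neg (by omega), show (k + 2 * (i - k / 2)) / 2 = i by omega] at e
  refine ⟨fun n => if n % 2 = 0 then h₀ (n / 2) else h₁ (n / 2),
    fun n => if n % 2 = 0 then w₀ (n / 2) else w₁ (n / 2), fun k l => ?_, glue h₀ h₁ hh₀ hh₁,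
    glue w₀ w₁ hw₀ hw₁⟩
  rcases Int.emod_two_eq_zero_or_one (k + l) with hk | hk
  · have e := H₀ ((k + l) / 2) ((k - l) / 2)
    rw [show (k + l) / 2 + (k - l) / 2 = k by omega,
      show (k + l) / 2 - (k - l) / 2 = l by omega] at e
    simp only
    rw [if_pos hk, if_pos (by omega), e]
  · have e := H₁ ((k + l) / 2) ((k - l) / 2)
    rw [show (k + l) / 2 + (k - l) / 2 + 1 = k by omega,
      show (k + l) / 2 - (k - l) / 2 = l by omega] at e
    simp only
    rw [if_neg (by omega), if_neg (by omega), e]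

/-- The effect of `t` on a splitting of the products of two lines. -/
theorem step_of_product {t : X} {f g h w : ℤ → X} (hf : IsLine t f)
    (H : ∀ k l, M (f k) * M (g l) = M (h (k + l)) + M (w (k - l))) (n i : ℤ) :
    M t * (M (h n) + M (w (n + 2 * i))) = M (h (n + 1)) + M (h (n - 1)) +
      (M (w (n + 2 * i + 1)) + M (w (n + 2 * i - 1))) := by
  have e0 := H (n + i) (-i)
  have e1 := H (n + i + 1) (-i)
  have e2 := H (n + i - 1) (-i)
  have e3 := M.line_step hf (k := n + i) rfl rfl
  rw [show n + i + -i = n by ring, show n + i - -i = n + 2 * i by ring] at e0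
  rw [show n + i + 1 + -i = n + 1 by ring, show n + i + 1 - -i = n + 2 * i + 1 by ring] at e1
  rw [show n + i - 1 + -i = n - 1 by ring, show n + i - 1 - -i = n + 2 * i - 1 by ring] at e2
  linear_combination e1 + e2 - M t * e0 + M (g (-i)) * e3

/-- The square of a line: in a coset group, `h k = π (a ^ k * b ^ 2)`. -/
theorem exists_line_sq {t : X} (h2 : powLine t 2 ≠ one) (h4 : powLine t 4 ≠ one)
    {f : ℤ → X} (hf : IsLine t f) :
    ∃ h : ℤ → X, IsLine t h ∧
      ∀ k l, M (f k) * M (f l) = M (h (k + l)) + M (powLine t (k - l)) := by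
  obtain ⟨h, w, H, hh, -⟩ := M.exists_product h2 h4 hf hf
  obtain ⟨h', H', -⟩ := M.exists_self_product h2 h4 hf
  have hw0 : w 0 = one := by
    by_contra hne
    refine hh 0 one fun i => ?_
    obtain ⟨s, hs⟩ := M.exists_sq (f i)
    have e := H i i
    rw [hs, ← M.map_one, sub_self, show i + i = 0 + 2 * i by ring] at e
    rcases M.eq_or_eq_of_add e with e | e
    · exact e.1.symm
    · exact absurd e.1.symm hne
  have hwneg : w (-1) = w 1 := M.injective (by
    have e1 := H 0 1
    have e2 := H 1 0
    norm_num at e1 e2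
    linear_combination e2 - e1)
  have hw2 : w 2 = powLine t 2 := M.injective (by
    have e1 := H 1 1
    have e2 := H 2 0
    have e3 := H' 1 0
    have e4 := H' 1 1
    norm_num [M.map_powLine_zero, hw0, M.map_one] at e1 e2 e3 e4
    linear_combination e1 - e2 - e3 + e4)
  have hstep := M.step_of_product hf H
  have ht : M (powLine t 0) = 2 := M.map_powLine_zero t
  have hw1 : w 1 = t := by
    by_contra hne
    refine hh 1 t fun i => ?_
    have e := hstep (2 * i) (-i)
    rw [show 2 * i + 2 * -i = 0 by ring, zero_add, zero_sub, hwneg, hw0, M.map_one] at e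
    obtain ⟨a, b, -, hab⟩ := M.exists_mul t (h (2 * i))
    have e' : M t + M t + (M a + M b) =
        M (h (2 * i + 1)) + M (h (2 * i - 1)) + (M (w 1) + M (w 1)) := by
      linear_combination e - hab
    have e2 := M.add_eq_add_of_disjoint e' (Ne.symm hne) (Ne.symm hne) (Ne.symm hne) (Ne.symm hne)
    rw [add_comm 1]
    rcases M.eq_or_eq_of_add e2 with e | e
    · exact e.1.symm
    · exact e.2.symm
  have hline : ∀ n, M t * M (h n) = M (h (n + 1)) + M (h (n - 1)) := by
    intro n
    rcases Int.emod_two_eq_zero_or_one n with hn | hn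
    · have e := hstep n (-(n / 2))
      rw [show n + 2 * -(n / 2) = 0 by omega, zero_add, zero_sub, hwneg, hw0, hw1, M.map_one] at e
      linear_combination e
    · have e := hstep n (-(n / 2))
      have e2 := M.powLine_mul_powLine t (d := 1) (k := 1) (a := 2) (b := 0) rfl rfl
      rw [show n + 2 * -(n / 2) = 1 by omega, sub_self, hw0, hw1, show (1 : ℤ) + 1 = 2 by rfl, hw2,
        M.map_one] at e
      rw [powLine_one, ht] at e2
      linear_combination e - e2
  refine ⟨h, M.isLine_iff.2 fun n => by rw [hline n, add_comm], fun k l => ?_⟩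
  have hw : w = powLine t := by
    refine IsLine.ext (M.isLine_iff.2 fun n => ?_) (isLine_powLine M.involutive t) hw0 hw1
    have e := hstep n 0
    rw [mul_zero, add_zero] at e
    linear_combination e - hline n
  rw [H k l, hw]

/-- The key step: the splitting of the products of two lines consists of lines. The defect
`C = t * h n - h (n + 1) - h (n - 1)` is annihilated by `f` and therefore by `t ^ 2 - e`. If `C` is
a difference of two elements, it vanishes. Otherwise `[h (n - 1), h (n + 1)]` is the negative part of
`C`, which depends on the parity of `n` only, and this forces the line `g` to have period four. -/
theorem isLine_of_product {t : X} (h2 : powLine t 2 ≠ one) (h4 : powLine t 4 ≠ one)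
    {f g h w : ℤ → X} (hf : IsLine t f) (hg : IsLine t g)
    (H : ∀ k l, M (f k) * M (g l) = M (h (k + l)) + M (w (k - l))) :
    IsLine t h := by
  obtain ⟨f₂, hf₂, Hf⟩ := M.exists_line_sq h2 h4 hf
  obtain ⟨h', w', H', -, hw'⟩ := M.exists_product h2 h4 hf₂ hg
  -- in a coset group, `f k = π (a ^ k * b)`, `g k = π (a ^ k * c)`, `h k = π (a ^ k * b * c)` and
  -- `h' k = π (a ^ k * b ^ 2 * c)`
  have hfh : ∀ k n, M (f k) * M (h n) = M (g (n - k)) + M (h' (n + k)) := by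
    intro k n
    obtain ⟨v, hv⟩ : ∃ v, M (f k) * M (h n) = M (g (n - k)) + M v := by
      have e := H k (n - k)
      rw [add_sub_cancel] at e
      exact M.exists_mul_of_mul e
    rw [hv]
    by_contra hne
    refine hw' (n + k) v fun i => ?_
    obtain ⟨v', hv'⟩ : ∃ v', M (f k) * M (w (n + 2 * i)) = M (g (k - (n + 2 * i))) + M v' := by
      have e := H k (k - (n + 2 * i))
      rw [sub_sub_cancel] at e
      exact M.exists_mul_of_mul (e.trans (add_comm _ _))
    have e1 := H (n + i) (-i)
    have e2 := Hf k (n + i)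
    have e3 := H' (k + (n + i)) (-i)
    have e4 := M.line_mul (d := k - (n + i)) (k := -i) (a := k - (n + 2 * i)) (b := n - k) hg
      (by ring) (by ring)
    rw [show n + i + -i = n by ring, show n + i - -i = n + 2 * i by ring] at e1
    rw [show k + (n + i) + -i = n + k by ring,
      show k + (n + i) - -i = n + k + 2 * i by ring] at e3
    have e5 : M v + M v' = M (h' (n + k)) + M (w' (n + k + 2 * i)) := by
      linear_combination e3 + e4 - hv - hv' + M (g (-i)) * e2 - M (f k) * e1
    rcases M.eq_or_eq_of_add e5 with e | e
    · exact absurd (by rw [e.1]) hne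
    · exact e.1.symm
  have hstep := M.step_of_product hf H
  have hfC : ∀ n k, M (f k) * (M t * M (h n) - M (h (n + 1)) - M (h (n - 1))) = 0 := by
    intro n k
    have e0 := M.line_step hf (k := k) rfl rfl
    have e1 := hfh (k + 1) n
    have e2 := hfh (k - 1) n
    have e3 := hfh k (n + 1)
    have e4 := hfh k (n - 1)
    rw [show n - (k + 1) = n - 1 - k by ring, show n + (k + 1) = n + 1 + k by ring] at e1
    rw [show n - (k - 1) = n + 1 - k by ring, show n + (k - 1) = n - 1 + k by ring] at e2
    linear_combination M (h n) * e0 + e1 + e2 - e3 - e4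
  have hC : ∀ n, (M (powLine t 2) - 2) * (M t * M (h n) - M (h (n + 1)) - M (h (n - 1))) = 0 := by
    intro n
    have e0 := Hf 0 0
    have e1 := Hf 1 (-1)
    norm_num [M.map_powLine_zero] at e0 e1
    linear_combination M (f (-1)) * hfC n 1 - M (f 0) * hfC n 0 +
      (M t * M (h n) - M (h (n + 1)) - M (h (n - 1))) * (e0 - e1)
  refine M.isLine_iff.2 fun n => ?_
  obtain ⟨p, p', -, hp⟩ := M.exists_mul t (h n)
  have hCn := hC n
  rw [hp] at hCn ⊢
  by_contra hne
  -- a common element of `t * h n` and `[h (n + 1), h (n - 1)]` would leave a difference of two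
  -- elements annihilated by `t ^ 2 - e`
  have d1 : h (n + 1) ≠ p := fun e => hne (by
    rw [← M.eq_of_powLine_two_mul h2 h4 (p := p') (q := h (n - 1))
      (by rw [e] at hCn; linear_combination hCn), e, add_comm])
  have d2 : h (n + 1) ≠ p' := fun e => hne (by
    rw [← M.eq_of_powLine_two_mul h2 h4 (p := p) (q := h (n - 1))
      (by rw [e] at hCn; linear_combination hCn), e])
  have d3 : h (n - 1) ≠ p := fun e => hne (by
    rw [← M.eq_of_powLine_two_mul h2 h4 (p := p') (q := h (n + 1))
      (by rw [e] at hCn; linear_combination hCn), e])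
  have d4 : h (n - 1) ≠ p' := fun e => hne (by
    rw [← M.eq_of_powLine_two_mul h2 h4 (p := p) (q := h (n + 1))
      (by rw [e] at hCn; linear_combination hCn), e, add_comm])
  have hconst : ∀ i, M (h (n + 1)) + M (h (n - 1)) =
      M (h (n + 2 * i + 1)) + M (h (n + 2 * i - 1)) := by
    intro i
    obtain ⟨q, q', -, hq⟩ := M.exists_mul t (h (n + 2 * i))
    refine M.add_eq_add_of_disjoint (c := q) (d := q') (c' := p) (d' := p') ?_ d1 d2 d3 d4
    have e1 := hstep n 0
    have e2 := hstep (n + 2 * i) (-i)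
    rw [mul_zero, add_zero] at e1
    rw [show n + 2 * i + 2 * -i = n by ring] at e2
    linear_combination e2 - e1 + hp - hq
  have hper : ∀ i, h (n + 2 * i + 3) = h (n + 2 * i - 1) := fun i => M.injective (by
    have e1 := hconst i
    have e2 := hconst (i + 1)
    rw [show n + 2 * (i + 1) + 1 = n + 2 * i + 3 by ring,
      show n + 2 * (i + 1) - 1 = n + 2 * i + 1 by ring] at e2
    linear_combination e1 - e2)
  refine M.line_not_periodic_four h2 h4 hg fun a => ?_
  have key : ∀ i, M (g a) + M (h' (2 * (n + 2 * i - 1) - a)) =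
      M (g (a + 4)) + M (h' (2 * (n + 2 * i - 1) - a + 4)) := by
    intro i
    have e1 := hfh (n + 2 * i - 1 - a) (n + 2 * i - 1)
    have e2 := hfh (n + 2 * i - 1 - a) (n + 2 * i + 3)
    rw [sub_sub_cancel, show n + 2 * i - 1 + (n + 2 * i - 1 - a) = 2 * (n + 2 * i - 1) - a by ring]
      at e1
    rw [hper i, show n + 2 * i + 3 - (n + 2 * i - 1 - a) = a + 4 by ring,
      show n + 2 * i + 3 + (n + 2 * i - 1 - a) = 2 * (n + 2 * i - 1) - a + 4 by ring] at e2
    linear_combination e2 - e1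
  rcases M.eq_or_eq_of_add (key 0) with e | e
  · exact e.1.symm
  rcases M.eq_or_eq_of_add (key 1) with e' | e'
  · exact e'.1.symm
  rw [← e'.2, e.1]
  congr 1
  ring

/-- The products of two lines split into two lines. -/
theorem exists_line_product {t : X} (h2 : powLine t 2 ≠ one) (h4 : powLine t 4 ≠ one)
    {f g : ℤ → X} (hf : IsLine t f) (hg : IsLine t g) :
    ∃ h w : ℤ → X, IsLine t h ∧ IsLine t w ∧
      ∀ k l, M (f k) * M (g l) = M (h (k + l)) + M (w (k - l)) := by
  obtain ⟨h, w, H, -, -⟩ := M.exists_product h2 h4 hf hg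
  refine ⟨h, w, M.isLine_of_product h2 h4 hf hg H, ?_, H⟩
  refine M.isLine_of_product h2 h4 hf hg.comp_neg (w := h) fun k l => ?_
  rw [H k (-l), add_comm, sub_neg_eq_add, sub_eq_add_neg]

/-- If two splittings differ at `n`, then `w'` is constant on the parity class of `n`, so it is not a
line. -/
theorem line_product_unique (M : Linearization X R) {t : X} (h2 : powLine t 2 ≠ one)
    (h4 : powLine t 4 ≠ one) {f g h w h' w' : ℤ → X} (hw' : IsLine t w')
    (H : ∀ k l, M (f k) * M (g l) = M (h (k + l)) + M (w (k - l)))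
    (H' : ∀ k l, M (f k) * M (g l) = M (h' (k + l)) + M (w' (k - l))) : h = h' := by
  funext n
  by_contra hne
  refine M.line_not_const h2 h4 hw' n (h n) fun i => ?_
  have e := (H (n + i) (-i)).symm.trans (H' (n + i) (-i))
  rw [show n + i + -i = n by ring, show n + i - -i = n + 2 * i by ring] at e
  rcases M.eq_or_eq_of_add e with e | e
  · exact absurd e.1 hne
  · exact e.1.symm

/-- Associativity of the product of lines: a mixed second difference of the two expansions of
`f i * g j * k l` shows that `t ^ 2 - e` annihilates `p n - p' n`. -/
theorem line_product_assoc {t : X} (h2 : powLine t 2 ≠ one) (h4 : powLine t 4 ≠ one)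
    {f g k h w p v q r p' v' : ℤ → X} (hf : IsLine t f) (hk : IsLine t k)
    (hw : IsLine t w) (hp : IsLine t p) (hr : IsLine t r) (hp' : IsLine t p')
    (Hfg : ∀ i j, M (f i) * M (g j) = M (h (i + j)) + M (w (i - j)))
    (Hhk : ∀ i j, M (h i) * M (k j) = M (p (i + j)) + M (v (i - j)))
    (Hgk : ∀ i j, M (g i) * M (k j) = M (q (i + j)) + M (r (i - j)))
    (Hfq : ∀ i j, M (f i) * M (q j) = M (p' (i + j)) + M (v' (i - j))) : p = p' := by
  obtain ⟨a, a', -, -, Ha⟩ := M.exists_line_product h2 h4 hw hk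
  obtain ⟨b, b', -, -, Hb⟩ := M.exists_line_product h2 h4 hf hr
  have key : ∀ i j l, M (p (i + j + l)) + M (v (i + j - l)) + M (a (i - j + l)) +
      M (a' (i - j - l)) = M (p' (i + j + l)) + M (v' (i - j - l)) + M (b (i + j - l)) +
        M (b' (i - j + l)) := by
    intro i j l
    have e1 := Hfq i (j + l)
    have e2 := Hb i (j - l)
    rw [← add_assoc, ← sub_sub] at e1
    rw [show i + (j - l) = i + j - l by ring, show i - (j - l) = i - j + l by ring] at e2
    linear_combination e1 + e2 - Hhk (i + j) l - Ha (i - j) l - M (k l) * Hfg i j + M (f i) * Hgk j l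
  funext n
  refine M.eq_of_powLine_two_mul h2 h4 ?_
  have e1 := key n 1 1
  have e2 := key (n - 1) 1 0
  have e3 := key (n - 1) 0 1
  have e4 := key (n - 2) 0 0
  have d1 := M.line_mul (d := 2) (k := n) (a := n + 2) (b := n - 2) hp rfl rfl
  have d2 := M.line_mul (d := 2) (k := n) (a := n + 2) (b := n - 2) hp' rfl rfl
  simp only [sub_add_cancel, add_sub_cancel_right, add_zero, sub_zero] at e1 e2 e3 e4
  rw [show n + 1 + 1 = n + 2 by ring, show n - 1 - 1 = n - 2 by ring] at e1
  rw [show n - 1 - 1 = n - 2 by ring] at e2 e3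
  linear_combination d1 - d2 + e1 - e2 - e3 + e4

end Linearization

/-! ### The group of lines -/

theorem order_eq {X : Type*} [TwoValuedGroup X] {t : X} {k : ℕ} (hk : 1 ≤ k)
    (h : pow t k = one) (hlt : ∀ j, 1 ≤ j → j < k → pow t j ≠ one) : order t = k := by
  refine le_antisymm (iInf₂_le k ⟨hk, h⟩) (le_iInf₂ fun j hj => ?_)
  by_contra hjk
  exact hlt j hj.1 (by exact_mod_cast not_le.1 hjk) hj.2

theorem powLine_ne_one {X : Type*} [TwoValuedGroup X] (hinv : IsInvolutive X) {t : X}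
    (h1 : order t ≠ 1) (h2 : order t ≠ 2) (h4 : order t ≠ 4) :
    powLine t 2 ≠ one ∧ powLine t 4 ≠ one := by
  have k1 : pow t 1 ≠ one := fun h => h1 (by
    exact_mod_cast order_eq (k := 1) le_rfl h fun j hj hj' => absurd hj (by omega))
  have k2 : pow t 2 ≠ one := fun h => h2 (by
    refine (order_eq (k := 2) (by norm_num) h fun j hj hj' => ?_).trans (by norm_num)
    obtain rfl : j = 1 := by omega
    exact k1)
  refine ⟨k2, fun h => h4 ((order_eq (k := 4) (by norm_num) h ?_).trans (by norm_num))⟩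
  intro j hj hj' h'
  have : j = 1 ∨ j = 2 ∨ j = 3 := by omega
  rcases this with rfl | rfl | rfl
  · exact k1 h'
  · exact k2 h'
  · have e := mul_pow_succ hinv t 2
    have h : pow t 4 = one := h
    rw [h', h, mul_one] at e
    have e' : (one : X) ∈ s(t, t) := by rw [e]; exact Sym2.mem_mk_right _ _
    rw [Sym2.mem_iff, or_self] at e'
    exact k1 e'.symm

/-- Every element `y` of `t * x` extends to a line through `x` and `y`. -/
theorem exists_isLine {X : Type*} [TwoValuedGroup X] (hinv : IsInvolutive X)
    (hcomm : IsCommutative X) {t x y : X} (h : y ∈ mul t x) :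
    ∃ f : ℤ → X, IsLine t f ∧ f 0 = x ∧ f 1 = y := by
  have hsymm : ∀ {x y : X}, y ∈ mul t x → x ∈ mul t y := fun {x y} h => by
    rw [hcomm t y]
    exact mem_mul_of_mem_mul hinv (mem_mul_of_mem_mul hinv h)
  have hmem : ∀ {z : Sym2 X} {a : X}, a ∈ z → remove z a ∈ z := fun {z a} h => by
    have := Sym2.mem_mk_right a (remove z a)
    rwa [remove_spec h] at this
  have hrem : ∀ {z : Sym2 X} {a : X}, a ∈ z → remove z (remove z a) = a := fun {z a} h => by
    have := (remove_spec (hmem h)).trans (remove_spec h).symm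
    rw [Sym2.eq_swap] at this
    exact Sym2.congr_left.1 this
  -- the shift of a line, as a permutation of the pairs of consecutive elements
  let σ : Equiv.Perm {p : X × X // p.2 ∈ mul t p.1} :=
    { toFun := fun p => ⟨(p.1.2, remove (mul t p.1.2) p.1.1), hmem (hsymm p.2)⟩
      invFun := fun p => ⟨(remove (mul t p.1.1) p.1.2, p.1.1), hsymm (hmem p.2)⟩
      left_inv := fun p => Subtype.ext (Prod.ext (hrem (hsymm p.2)) rfl)
      right_inv := fun p => Subtype.ext (Prod.ext rfl (hrem p.2)) }
  have hσ : ∀ k : ℤ, (σ ^ (k + 1)) ⟨(x, y), h⟩ = σ ((σ ^ k) ⟨(x, y), h⟩) := fun k => by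
    rw [add_comm, zpow_add, zpow_one, Equiv.Perm.mul_apply]
  refine ⟨fun k => ((σ ^ k) ⟨(x, y), h⟩).1.1, fun k => ?_, rfl, rfl⟩
  obtain ⟨j, rfl⟩ : ∃ j, k = j + 1 := ⟨k - 1, by ring⟩
  simp only [add_sub_cancel_right, hσ]
  exact (remove_spec (hsymm ((σ ^ j) ⟨(x, y), h⟩).2)).symm

/-- The set of `t`-lines. In a coset group `A / ι_a` with `t = π a` and `a ^ 2 ≠ 1`, the element
`b` of `A` is determined by the line `k ↦ π (a ^ k * b)`. -/
@[ext]
structure Lines {X : Type*} [TwoValuedGroup X] (t : X) where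
  /-- the sequence of elements of the line -/
  toFun : ℤ → X
  isLine : IsLine t toFun

variable {X : Type u} [TwoValuedGroup X]

/-- The line `h` is a product of the lines `f` and `g`, with a line `w` in the role of
`f * g⁻¹`. -/
def Lines.IsProd {t : X} (f g h : Lines t) : Prop :=
  ∃ w : Lines t, ∀ k l, mul (f.1 k) (g.1 l) = s(h.1 (k + l), w.1 (k - l))

theorem Lines.exists_isProd (hinv : IsInvolutive X) (hcomm : IsCommutative X) {t : X}
    (h2 : powLine t 2 ≠ one) (h4 : powLine t 4 ≠ one) (f g : Lines t) :
    ∃ h, IsProd f g h := by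
  obtain ⟨R, _, ⟨M⟩⟩ := exists_linearization hinv hcomm
  obtain ⟨h, w, hh, hw, H⟩ := M.exists_line_product h2 h4 f.2 g.2
  exact ⟨⟨h, hh⟩, ⟨w, hw⟩, fun k l => M.mul_eq_iff.2 (H k l)⟩

theorem Lines.IsProd.unique (hinv : IsInvolutive X) (hcomm : IsCommutative X) {t : X}
    (h2 : powLine t 2 ≠ one) (h4 : powLine t 4 ≠ one) {f g h h' : Lines t}
    (H : IsProd f g h) (H' : IsProd f g h') : h = h' := by
  obtain ⟨R, _, ⟨M⟩⟩ := exists_linearization hinv hcomm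
  obtain ⟨w, H⟩ := H
  obtain ⟨w', H'⟩ := H'
  exact Lines.ext (M.line_product_unique h2 h4 w'.2 (fun k l => M.mul_eq_iff.1 (H k l))
    fun k l => M.mul_eq_iff.1 (H' k l))

/-- Lines form an abelian group; the identity is the line of powers of `t`, and inversion is the
reflection of a line. -/
theorem Lines.exists_commGroup (hinv : IsInvolutive X) (hcomm : IsCommutative X) {t : X}
    (h2 : powLine t 2 ≠ one) (h4 : powLine t 4 ≠ one) :
    ∃ _ : CommGroup (Lines t), (∀ f g : Lines t, IsProd f g (f * g)) ∧
      (∀ (f : Lines t) k, (f⁻¹).1 k = f.1 (-k)) ∧ (1 : Lines t).1 = powLine t := by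
  obtain ⟨R, _, ⟨M⟩⟩ := exists_linearization hinv hcomm
  choose m hm using fun f g : Lines t => exists_isProd hinv hcomm h2 h4 f g
  have uniq : ∀ {f g h : Lines t}, IsProd f g h → m f g = h := fun {f g _} H =>
    (hm f g).unique hinv hcomm h2 h4 H
  have hmul_comm : ∀ f g, m f g = m g f := fun f g => uniq (by
    obtain ⟨w, H⟩ := hm g f
    refine ⟨⟨fun k => w.1 (-k), w.2.comp_neg⟩, fun k l => ?_⟩
    rw [hcomm, H l k, add_comm l k, ← neg_sub k l])
  let e : Lines t := ⟨powLine t, isLine_powLine hinv t⟩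
  let i : Lines t → Lines t := fun f => ⟨fun k => f.1 (-k), f.2.comp_neg⟩
  have hone : ∀ f, m e f = f := fun f => uniq ⟨i f, fun k l => by
    rw [M.mul_eq_iff]
    exact M.line_mul f.2 (add_comm k l) (neg_sub k l)⟩
  have hinv_mul : ∀ f, m (i f) f = e := fun f => (hmul_comm (i f) f).trans (uniq (by
    obtain ⟨h, hh, H⟩ := M.exists_line_sq h2 h4 f.2
    refine ⟨⟨h, hh⟩, fun k l => M.mul_eq_iff.2 ((H k (-l)).trans ?_)⟩
    rw [add_comm, sub_neg_eq_add, ← sub_eq_add_neg]))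
  have hassoc : ∀ f g k, m (m f g) k = m f (m g k) := fun f g k => by
    obtain ⟨w, H₁⟩ := hm f g
    obtain ⟨v, H₂⟩ := hm (m f g) k
    obtain ⟨r, H₃⟩ := hm g k
    obtain ⟨v', H₄⟩ := hm f (m g k)
    exact Lines.ext (M.line_product_assoc h2 h4 f.2 k.2 w.2 (m (m f g) k).2 r.2
      (m f (m g k)).2 (fun a b => M.mul_eq_iff.1 (H₁ a b)) (fun a b => M.mul_eq_iff.1 (H₂ a b))
      (fun a b => M.mul_eq_iff.1 (H₃ a b)) fun a b => M.mul_eq_iff.1 (H₄ a b))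
  let : Mul (Lines t) := ⟨m⟩
  let : Inv (Lines t) := ⟨i⟩
  let : One (Lines t) := ⟨e⟩
  let G : Group (Lines t) := Group.ofLeftAxioms hassoc hone hinv_mul
  exact ⟨{ G with mul_comm := hmul_comm }, hm, fun _ _ => rfl, rfl⟩

/-! ### The topology on the group of lines -/

/-- A line is determined by its values at `0` and `1`; the set of lines carries the topology of a
subspace of `X × X`. -/
instance [TopologicalSpace X] {t : X} : TopologicalSpace (Lines t) :=
  TopologicalSpace.induced (fun f => (f.1 0, f.1 1)) inferInstance

theorem isOpen_sym2_pairs {X : Type*} [TopologicalSpace X] {U V : Set X} (hU : IsOpen U)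
    (hV : IsOpen V) :
    IsOpen {z : Sym2 X | ∃ a ∈ U, ∃ b ∈ V, z = s(a, b)} := by
  refine isOpen_coinduced.2 ?_
  have : (fun p : X × X => s(p.1, p.2)) ⁻¹' {z : Sym2 X | ∃ a ∈ U, ∃ b ∈ V, z = s(a, b)} =
      U ×ˢ V ∪ V ×ˢ U := by
    ext ⟨x, y⟩
    simp only [Set.mem_preimage, Set.mem_ofPred_eq, Set.mem_union, Set.mem_prod, Sym2.eq_iff]
    constructor
    · rintro ⟨a, ha, b, hb, ⟨rfl, rfl⟩ | ⟨rfl, rfl⟩⟩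
      · exact Or.inl ⟨ha, hb⟩
      · exact Or.inr ⟨hb, ha⟩
    · rintro (⟨hx, hy⟩ | ⟨hx, hy⟩)
      · exact ⟨x, hx, y, hy, Or.inl ⟨rfl, rfl⟩⟩
      · exact ⟨y, hy, x, hx, Or.inr ⟨rfl, rfl⟩⟩
  rw [this]
  exact (hU.prod hV).union (hV.prod hU)

theorem eventually_mem_pair {X Y : Type*} [TopologicalSpace X] [TopologicalSpace Y] {φ : Y → Sym2 X}
    {y₀ : Y} (hφ : ContinuousAt φ y₀) {U V : Set X} (hU : IsOpen U) (hV : IsOpen V) {a b : X}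
    (ha : a ∈ U) (hb : b ∈ V) (h₀ : φ y₀ = s(a, b)) :
    ∀ᶠ y in 𝓝 y₀, ∀ c d, φ y = s(c, d) → c ∈ U ∧ d ∈ V ∨ c ∈ V ∧ d ∈ U := by
  filter_upwards [hφ ((isOpen_sym2_pairs hU hV).mem_nhds ⟨a, ha, b, hb, h₀⟩)] with y hy c d hcd
  obtain ⟨a', ha', b', hb', e⟩ := hy
  rw [hcd, Sym2.eq_iff] at e
  rcases e with ⟨rfl, rfl⟩ | ⟨rfl, rfl⟩
  · exact Or.inl ⟨ha', hb'⟩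
  · exact Or.inr ⟨hb', ha'⟩

/-- If a two-element multiset and one of its elements vary continuously, then so does the other
element. -/
theorem continuous_other {X Y : Type*} [TopologicalSpace X] [T2Space X] [TopologicalSpace Y]
    {φ : Y → Sym2 X} {α β : Y → X} (hφ : Continuous φ) (hα : Continuous α)
    (h : ∀ y, φ y = s(α y, β y)) : Continuous β := by
  refine continuous_iff_continuousAt.2 fun y₀ => ?_
  intro W hW
  change ∀ᶠ y in 𝓝 y₀, β y ∈ W
  obtain ⟨V, hVW, hV, hy⟩ := mem_nhds_iff.1 hW
  by_cases hne : α y₀ = β y₀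
  · filter_upwards [eventually_mem_pair hφ.continuousAt hV hV (hne ▸ hy) hy (h y₀)] with y hy'
    rcases hy' _ _ (h y) with ⟨-, h'⟩ | ⟨-, h'⟩ <;> exact hVW h'
  · obtain ⟨U, V', hU, hV', hαU, hβV, hd⟩ := t2_separation hne
    filter_upwards [eventually_mem_pair hφ.continuousAt hU (hV'.inter hV) hαU ⟨hβV, hy⟩ (h y₀),
      hα.continuousAt (hU.mem_nhds hαU)] with y hy' hαy
    rcases hy' _ _ (h y) with ⟨-, h'⟩ | ⟨h', -⟩
    · exact hVW h'.2
    · exact absurd h'.1 (Set.disjoint_left.1 hd hαy)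

/-- A common element of two continuous families of two-element multisets varies continuously
wherever the remaining elements are different. -/
theorem continuousAt_of_common {X Y : Type*} [TopologicalSpace X] [T2Space X] [TopologicalSpace Y]
    {φ ψ : Y → Sym2 X} {α β γ : Y → X} {y₀ : Y} (hφ : Continuous φ) (hψ : Continuous ψ)
    (h : ∀ y, φ y = s(α y, β y)) (h' : ∀ y, ψ y = s(α y, γ y)) (hne : β y₀ ≠ γ y₀) :
    ContinuousAt α y₀ := by
  intro W hW
  change ∀ᶠ y in 𝓝 y₀, α y ∈ W
  obtain ⟨U, hUW, hU, hy⟩ := mem_nhds_iff.1 hW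
  obtain ⟨V, V', hV, hV', hβ, hγ, hd⟩ := t2_separation hne
  filter_upwards [eventually_mem_pair hφ.continuousAt hU hV hy hβ (h y₀),
    eventually_mem_pair hψ.continuousAt hU hV' hy hγ (h' y₀)] with y h1 h2
  rcases h1 _ _ (h y) with ⟨h3, -⟩ | ⟨h3, -⟩
  · exact hUW h3
  · rcases h2 _ _ (h' y) with ⟨h4, -⟩ | ⟨h4, -⟩
    · exact hUW h4
    · exact absurd h4 (Set.disjoint_left.1 hd h3)

theorem _root_.Continuous.twoValuedMul {Y : Type*} [TopologicalSpace X]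
    [IsTopologicalTwoValuedGroup X] [TopologicalSpace Y] {f g : Y → X}
    (hf : Continuous f) (hg : Continuous g) : Continuous fun y => mul (f y) (g y) :=
  IsTopologicalTwoValuedGroup.continuous_mul.comp (hf.prodMk hg)

theorem Lines.continuous_eval [TopologicalSpace X] [T2Space X] [IsTopologicalTwoValuedGroup X]
    {t : X} (n : ℤ) : Continuous fun f : Lines t => f.1 n := by
  have h01 : Continuous fun f : Lines t => (f.1 0, f.1 1) := continuous_induced_dom
  have key : (Continuous fun f : Lines t => f.1 n) ∧ Continuous fun f : Lines t => f.1 (n + 1) := by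
    induction n with
    | zero => exact ⟨h01.fst, h01.snd⟩
    | succ n ih =>
      refine ⟨ih.2, continuous_other ((continuous_const (y := t)).twoValuedMul ih.2) ih.1 fun f => ?_⟩
      have e := f.2 (n + 1)
      rwa [add_sub_cancel_right] at e
    | pred n ih =>
      rw [sub_add_cancel]
      refine ⟨continuous_other ((continuous_const (y := t)).twoValuedMul ih.1) ih.2 fun f => ?_, ih.1⟩
      rw [f.2 (-n), Sym2.eq_swap]
  exact key.1

theorem Lines.continuous_iff [TopologicalSpace X] [T2Space X] [IsTopologicalTwoValuedGroup X]
    {t : X} {Y : Type*} [TopologicalSpace Y] {φ : Y → Lines t} :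
    Continuous φ ↔ ∀ n, Continuous fun y => (φ y).1 n :=
  ⟨fun h n => (continuous_eval n).comp h, fun h =>
    continuous_induced_rng.2 ((h 0).prodMk (h 1))⟩

instance [TopologicalSpace X] [T2Space X] {t : X} : T2Space (Lines t) :=
  T2Space.of_injective_continuous (f := fun f : Lines t => (f.1 0, f.1 1))
    (fun f g h => Lines.ext (f.2.ext g.2 (congrArg Prod.fst h) (congrArg Prod.snd h)))
    continuous_induced_dom

/-- The product of lines is continuous. If `h = f * g` with complementary line `w`, the element
`h n` is common to the multisets `f (n + i) * g (-i) = [h n, w (n + 2 * i)]`, and `w` is not constant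
on a parity class. -/
theorem Lines.continuous_mul [TopologicalSpace X] [T2Space X] [IsTopologicalTwoValuedGroup X]
    (hinv : IsInvolutive X) (hcomm : IsCommutative X) {t : X}
    (h2 : powLine t 2 ≠ one) (h4 : powLine t 4 ≠ one) (m : Lines t → Lines t → Lines t)
    (hm : ∀ f g, IsProd f g (m f g)) : Continuous fun p : Lines t × Lines t => m p.1 p.2 := by
  obtain ⟨R, _, ⟨M⟩⟩ := exists_linearization hinv hcomm
  choose w H using hm
  refine continuous_iff.2 fun n => continuous_iff_continuousAt.2 fun p => ?_
  obtain ⟨i, hi⟩ := not_forall.1 (M.line_not_const h2 h4 (w p.1 p.2).2 n ((w p.1 p.2).1 n))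
  have hmul : ∀ i (p : Lines t × Lines t), mul (p.1.1 (n + i)) (p.2.1 (-i)) =
      s((m p.1 p.2).1 n, (w p.1 p.2).1 (n + 2 * i)) := fun i p => by
    rw [H p.1 p.2 (n + i) (-i)]
    exact congrArg₂ (fun a b => s((m p.1 p.2).1 a, (w p.1 p.2).1 b)) (by ring) (by ring)
  have hcont : ∀ i, Continuous fun p : Lines t × Lines t => mul (p.1.1 (n + i)) (p.2.1 (-i)) :=
    fun i => ((continuous_eval _).comp continuous_fst).twoValuedMul
      ((continuous_eval _).comp continuous_snd)
  refine continuousAt_of_common (hcont i) (hcont 0) (hmul i) (hmul 0) ?_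
  rwa [mul_zero, add_zero]

theorem Lines.isOpenMap_eval_zero [TopologicalSpace X] [IsTopologicalTwoValuedGroup X]
    (hinv : IsInvolutive X) (hcomm : IsCommutative X) {t : X} :
    IsOpenMap fun f : Lines t => f.1 0 := by
  intro W hW
  obtain ⟨W', hW', rfl⟩ := isOpen_induced_iff.1 hW
  refine isOpen_iff_mem_nhds.2 ?_
  rintro _ ⟨f, hf, rfl⟩
  obtain ⟨U, V, hU, hV, hfU, hfV, hUV⟩ := isOpen_prod_iff.1 hW' (f.1 0) (f.1 1) hf
  have hmul : Continuous fun x : X => mul t x := continuous_const.twoValuedMul continuous_id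
  have hopen := (isOpen_sym2_pairs isOpen_univ hV).preimage hmul
  filter_upwards [hU.mem_nhds hfU,
    hopen.mem_nhds ⟨f.1 (0 - 1), trivial, f.1 (0 + 1), by rwa [zero_add], f.2 0⟩] with x hx hx'
  obtain ⟨a, -, b, hb, e⟩ := hx'
  obtain ⟨g, hg, hg0, hg1⟩ := exists_isLine hinv hcomm (t := t) (x := x) (y := b)
    (by rw [show mul t x = s(a, b) from e]; exact Sym2.mem_mk_right _ _)
  refine ⟨⟨g, hg⟩, hUV ⟨?_, ?_⟩, hg0⟩
  · change g 0 ∈ U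
    rwa [hg0]
  · change g 1 ∈ V
    rwa [hg1]

end TwoValuedGroup

open TwoValuedGroup

theorem mainTheorem9 (X : Type u) [TopologicalSpace X] [T2Space X] [TwoValuedGroup X]
    [IsTopologicalTwoValuedGroup X]
    (hinv : TwoValuedGroup.IsInvolutive X) (hcomm : TwoValuedGroup.IsCommutative X)
    (hord : ∃ t : X, TwoValuedGroup.order t ≠ 1 ∧ TwoValuedGroup.order t ≠ 2 ∧
      TwoValuedGroup.order t ≠ 4) :
    ∃ (A : Type u) (_ : CommGroup A) (_ : TopologicalSpace A),
      IsTopologicalGroup A ∧ T2Space A ∧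
        Nonempty (TopologicalTwoValuedGroupIso X (AntipodalCoset A)) := by
  obtain ⟨t, h1, h2, h4⟩ := hord
  obtain ⟨h2, h4⟩ := powLine_ne_one hinv h1 h2 h4
  obtain ⟨G, hmul, hGinv, hone⟩ := Lines.exists_commGroup hinv hcomm h2 h4
  refine ⟨Lines t, G, inferInstance, ?_, inferInstance, ?_⟩
  · exact
      { continuous_mul := Lines.continuous_mul hinv hcomm h2 h4 (· * ·) hmul
        continuous_inv := Lines.continuous_iff.2 fun n => by
          simp only [hGinv]
          exact Lines.continuous_eval (-n) }
  let π := CosetTwoValued.proj (antipodal (Lines t)) (antipodal_involutive (Lines t))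
  have hπ : ∀ f g : Lines t, π f = π g ↔ f.1 0 = g.1 0 := by
    intro f g
    refine CosetTwoValued.proj_eq_iff.trans ⟨?_, fun h => ?_⟩
    · rintro (rfl | rfl)
      · rfl
      · exact (hGinv f 0).symm
    · have e := f.2 0
      rw [h, g.2 0, Sym2.eq_iff] at e
      rcases e with ⟨-, e⟩ | ⟨-, e⟩
      · exact Or.inl (Lines.ext (g.2.ext f.2 h.symm e))
      · refine Or.inr (Lines.ext (g.2.ext (f⁻¹).2 ?_ ?_))
        · exact h.symm.trans (hGinv f 0).symm
        · exact e.trans (hGinv f 1).symm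
  let q : AntipodalCoset (Lines t) → X :=
    Quotient.lift (fun f : Lines t => f.1 0) fun f g h => (hπ f g).1 (Quotient.sound h)
  have hq : ∀ f : Lines t, q (π f) = f.1 0 := fun _ => rfl
  have hbij : Function.Bijective q := by
    constructor
    · intro a b h
      obtain ⟨f, rfl⟩ := CosetTwoValued.proj_surjective a
      obtain ⟨g, rfl⟩ := CosetTwoValued.proj_surjective b
      exact (hπ f g).2 h
    · intro x
      obtain ⟨y, hy⟩ : ∃ y, y ∈ mul t x := by
        induction mul t x with | _ a b => exact ⟨a, Sym2.mem_mk_left _ _⟩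
      obtain ⟨f, hf, hf0, -⟩ := exists_isLine hinv hcomm hy
      exact ⟨π ⟨f, hf⟩, hf0⟩
  have hcont : Continuous q := (Lines.continuous_eval 0).quotient_lift _
  have hopen : IsOpenMap q := by
    intro U hU
    have e : q '' U = (fun f : Lines t => f.1 0) '' (π ⁻¹' U) := by
      ext x
      constructor
      · rintro ⟨a, ha, rfl⟩
        obtain ⟨f, rfl⟩ := CosetTwoValued.proj_surjective a
        exact ⟨f, ha, rfl⟩
      · rintro ⟨f, hf, rfl⟩
        exact ⟨π f, hf, rfl⟩
    rw [e]
    exact Lines.isOpenMap_eval_zero hinv hcomm _ (hU.preimage continuous_quot_mk)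
  let E : AntipodalCoset (Lines t) ≃ₜ X :=
    (Equiv.ofBijective q hbij).toHomeomorphOfContinuousOpen hcont hopen
  -- the inverse of `E` is the isomorphism
  have hE : ∀ f : Lines t, E.symm (f.1 0) = π f := fun f => E.symm_apply_apply (π f)
  have hsurj : ∀ x : X, ∃ f : Lines t, f.1 0 = x := fun x => by
    obtain ⟨a, ha⟩ := hbij.2 x
    obtain ⟨f, rfl⟩ := CosetTwoValued.proj_surjective a
    exact ⟨f, ha⟩
  refine ⟨{ E.symm with
    map_mul := fun x y => ?_
    map_one := ?_
    map_inv := fun x => ?_ }⟩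
  · obtain ⟨f, rfl⟩ := hsurj x
    obtain ⟨g, rfl⟩ := hsurj y
    change mul (E.symm (f.1 0)) (E.symm (g.1 0)) = (mul (f.1 0) (g.1 0)).map E.symm
    obtain ⟨w, hw⟩ := hmul f g
    have hwfg : f * g⁻¹ = w := (hmul f g⁻¹).unique hinv hcomm h2 h4 ⟨f * g, fun k l => by
      rw [hGinv, hw k (-l), Sym2.eq_swap, sub_neg_eq_add, ← sub_eq_add_neg]⟩
    rw [hE, hE, hw 0 0, Sym2.map_mk, add_zero, sub_zero, hE, hE, ← hwfg]
    rfl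
  · have e := hE 1
    rw [hone] at e
    exact e
  · obtain ⟨f, rfl⟩ := hsurj x
    change E.symm (inv (f.1 0)) = inv (E.symm (f.1 0))
    rw [hinv, hE]
    exact (CosetTwoValued.proj_map f).symm
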